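/- **Setting.** Let $M,K$ be natural numbers. A beamformer is $F=[f_1,\dots,f_K]\in\mathbb C^{M\times K}$ with Frobenius norm $\|F\|$; the feasible set is $\Lambda=\{F:\mathrm{Tr}(FF^H)\le P_{\max}\}$, $P_{\max}>0$. For $k=1,\dots,K$ let $\sigma_k,\delta_k,S_k,a_k>0$, $\omega_k,\gamma_k\ge 0$, $b_k\in\mathbb R$, $\rho_k\in(0,1]$, $v_k\ge0$ and $\hat h_k\in\mathbb C^M$ be given; $\hat H=[\hat h_1,\dots,\hat h_K]$. For a channel $h\in\mathbb C^M$ put $\Gamma(h,F)=\sum_{m}|h^Hf_m|^2$, $$r_k(h,F)=\log_2\Big(1+\frac{\rho_k|h^Hf_k|^2}{\rho_k(\sum_{m\ne k}|h^Hf_m|^2+\sigma_k^2)+\delta_k^2}\Big),\qquad e_k(h,F)=\frac{\Psi_k(h,F)-S_k\Omega_k}{1-\Omega_k},$$ $$\Psi_k(h,F)=\frac{S_k}{1+\exp(-a_k((1-\rho_k)(\Gamma(h,F)+\sigma_k^2)-b_k))},\qquad \Omega_k=\frac1{1+\exp(a_kb_k)}.$$ Problem $P_2(\rho,v,\hat H)$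 is to maximize over $F\in\Lambda$ the function $\sum_k v_k\big(\mathbb E[r_k(\hat h_k+\phi_k,F)]+\gamma_k\mathbb E[e_k(\hat h_k+\phi_k,F)]\big)$, where $\phi_k\sim\mathcal{CN}(0,\omega_k^2I_M)$. A point $F\in\Lambda$ is stationary if the (real) derivative of the objective at $F$ in direction $G-F$ is $\le0$ for every $G\in\Lambda$; $\mathcal F^*$ denotes the set of stationary points. Let $(\phi_k^n)_{n\ge1}$ be random vectors with law $\mathcal{CN}(0,\omega_k^2I_M)$ that are, for each $k$, independent over $n$; put $h_k^n=\hat h_k+\phi_k^n$. The sample average objective is $\hat f_N(F)=\frac1N\sum_{k}\sum_{n=1}^N v_k(r_k(h_k^n,F)+\gamma_ke_k(h_k^n,F))$. **The short-term FP-BCD iteration with $N$ samples.** Start from any $\tilde F\in\Lambda$ and repeat, $\tilde F$ being the last iterate. (1) $q_k^n=\frac{\rho_k|(h_k^n)^H\tilde f_k|^2}{\rho_k(\Gamma(h_k^n,\tilde F)-|(h_k^n)^H\tilde f_k|^2+\sigma_k^2)+\delta_k^2}$. (2) $w_k^n=\frac{\sqrt{\rho_kv_k(1+q_k^n)}}{\rho_k(\Gamma(h_k^n,\tilde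 F)+\sigma_k^2)+\delta_k^2}\,(h_k^n)^H\tilde f_k$. (3) The next iterate is the $F$-part of a maximizer, over $F\in\Lambda$ and $\varsigma_k^n\ge0$, of $$\frac1N\sum_{n=1}^N\sum_{k}\Big(\hat r_k^n(F)+v_k\gamma_k\frac{S_k}{1-\Omega_k}\varsigma_k^n\Big),$$ $$\hat r_k^n(F)=\frac{1}{\ln2}\Big(2\sqrt{\rho_kv_k(1+q_k^n)}\,\mathrm{Re}\{f_k^Hh_k^nw_k^n\}-|w_k^n|^2\big(\rho_k(\Gamma(h_k^n,F)+\sigma_k^2)+\delta_k^2\big)+v_k\big(\ln(1+q_k^n)-q_k^n\big)\Big),$$ subject, for all $k,n$, to the linearized energy constraint $$d_k\sum_m (h_k^n)^H(\tilde f_m\tilde f_m^H+\tilde f_m\bar f_m^H+\bar f_m\tilde f_m^H)h_k^n+\ln\Big(\frac1{\tilde\varsigma_k^n+\Omega_k}-1\Big)+\frac{\varsigma_k^n-\tilde\varsigma_k^n}{(\tilde\varsigma_k^n+\Omega_k-1)(\tilde\varsigma_k^n+\Omega_k)}+c_k\ge0,$$ where $\bar f_m=f_m-\tilde f_m$, $d_k=a_k(1-\rho_k)$,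 $c_k=a_k\sigma_k^2(1-\rho_k)-a_kb_k$, and $\tilde\varsigma_k^n=\Psi_k(h_k^n,\tilde F)/S_k-\Omega_k$ is the value of $\varsigma_k^n$ at the last iterate. A *limiting point* of a run $(F^j)_{j\ge0}$ is the limit of $(F^j)$, if it exists; moreover every accumulation point of $(F^j)$ is one, if the run is minorizing, i.e. if in each pass the optimal value of (3) is at most the value of $\hat f_N$ at the next iterate. **Theorem 2.** For every $\epsilon>0$ there are constants $\hat a(\epsilon),\hat b(\epsilon)>0$, independent of $N$, such that for all sufficiently large $N$ $$\Pr\Big\{\min_{F\in\mathcal F^*}\|F^N-F\|\ge\epsilon\ \text{ for some limiting point } F^N \text{ of some run with } N \text{ samples}\Big\}\le\hat a(\epsilon)e^{-N\hat b(\epsilon)} .$$ In particular this holds when $\mathcal F^*$ is discrete and $F^N$ is the limiting point of the run from a given starting point. -/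

import Mathlib

open MeasureTheory ProbabilityTheory Filter Topology
open scoped NNReal ENNReal

noncomputable section

namespace SWIPT

/-- A channel vector in `ℂ^M`. -/
abbrev Channel (M : ℕ) := EuclideanSpace ℂ (Fin M)

/-- A digital beamformer `F = [f_1, …, f_K]`, with columns `F k = f_k`.  Its norm is the Frobenius
norm `(∑ k, ‖f_k‖ ^ 2) ^ (1 / 2)`. -/
abbrev Beamformer (M K : ℕ) := PiLp 2 (fun _ : Fin K => Channel M)

/-- The constants of the downlink with `M` antennas and `K` devices. -/
structure System (M K : ℕ) where
  /-- transmit power budget -/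
  Pmax : ℝ
  /-- standard deviations of the antenna noise -/
  σ : Fin K → ℝ
  /-- standard deviations of the noise of the information decoder -/
  δ : Fin K → ℝ
  /-- standard deviations of the channel error -/
  ω : Fin K → ℝ≥0
  /-- maximum harvested powers -/
  S : Fin K → ℝ
  /-- circuit parameters (steepness) -/
  a : Fin K → ℝ
  /-- circuit parameters (threshold) -/
  b : Fin K → ℝ
  /-- weights of the harvested powers -/
  γ : Fin K → ℝ
  Pmax_pos : 0 < Pmax
  σ_pos : ∀ k, 0 < σ k
  δ_pos : ∀ k, 0 < δ k
  S_pos : ∀ k, 0 < S k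
  a_pos : ∀ k, 0 < a k
  γ_nonneg : ∀ k, 0 ≤ γ k

/-- The law `CN(0, s)` on `ℂ`: independent real and imaginary parts, each `N(0, s / 2)`. -/
def complexGaussian (s : ℝ≥0) : Measure ℂ :=
  ((gaussianReal 0 (s / 2)).prod (gaussianReal 0 (s / 2))).map Complex.measurableEquivRealProd.symm

/-- The law `CN(0, s I_M)` on `ℂ^M`: independent coordinates, each `CN(0, s)`. -/
def channelErrorLaw (M : ℕ) (s : ℝ≥0) : Measure (Channel M) :=
  (Measure.pi (fun _ : Fin M => complexGaussian s)).map (MeasurableEquiv.toLp 2 (Fin M → ℂ))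

variable {M K : ℕ}

/-- The feasible set `Λ = {F | Tr(F Fᴴ) ≤ Pmax}`. -/
def feasible (P : System M K) : Set (Beamformer M K) :=
  {F | ∑ k, ‖F k‖ ^ 2 ≤ P.Pmax}

/-! ### Rate and harvested power for a given channel `h` of device `k` -/

/-- `Γ = ∑ m, |hᴴ f_m|²`. -/
def gain (h : Channel M) (F : Beamformer M K) : ℝ :=
  ∑ m, ‖inner ℂ h (F m)‖ ^ 2

/-- The signal to interference and noise ratio of device `k`. -/
def sinr (P : System M K) (ρ : Fin K → ℝ) (k : Fin K) (h : Channel M) (F : Beamformer M K) : ℝ :=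
  ρ k * ‖inner ℂ h (F k)‖ ^ 2 /
    (ρ k * ((∑ m ∈ Finset.univ.erase k, ‖inner ℂ h (F m)‖ ^ 2) + P.σ k ^ 2) + P.δ k ^ 2)

/-- The rate `log₂ (1 + SINR)`. -/
def rate (P : System M K) (ρ : Fin K → ℝ) (k : Fin K) (h : Channel M) (F : Beamformer M K) : ℝ :=
  Real.logb 2 (1 + sinr P ρ k h F)

/-- The input radio power `P_k` of the energy harvester. -/
def inputPower (P : System M K) (ρ : Fin K → ℝ) (k : Fin K) (h : Channel M)
    (F : Beamformer M K) : ℝ :=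
  (1 - ρ k) * (gain h F + P.σ k ^ 2)

/-- `Ψ_k`. -/
def psi (P : System M K) (ρ : Fin K → ℝ) (k : Fin K) (h : Channel M) (F : Beamformer M K) : ℝ :=
  P.S k / (1 + Real.exp (-P.a k * (inputPower P ρ k h F - P.b k)))

/-- `Ω_k`. -/
def omega (P : System M K) (k : Fin K) : ℝ :=
  1 / (1 + Real.exp (P.a k * P.b k))

/-- The harvested power `(Ψ_k - S_k Ω_k) / (1 - Ω_k)`. -/
def harvested (P : System M K) (ρ : Fin K → ℝ) (k : Fin K) (h : Channel M)
    (F : Beamformer M K) : ℝ :=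
  (psi P ρ k h F - P.S k * omega P k) / (1 - omega P k)

/-! ### The stochastic problem, its sample average approximation, stationary points -/

/-- The objective of the stochastic problem `P₂(ρ, v, Ĥ)`. -/
def trueObjective (P : System M K) (ρ v : Fin K → ℝ) (H : Fin K → Channel M)
    (F : Beamformer M K) : ℝ :=
  ∑ k, v k *
    ((∫ φ, rate P ρ k (H k + φ) F ∂(channelErrorLaw M (P.ω k ^ 2))) +
      P.γ k * ∫ φ, harvested P ρ k (H k + φ) F ∂(channelErrorLaw M (P.ω k ^ 2)))

/-- The objective of the sample average approximation `P₃(ρ, v, Ĥ)` with error samples `φ`. -/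
def saaObjective (P : System M K) (ρ v : Fin K → ℝ) (H : Fin K → Channel M) {N : ℕ}
    (φ : Fin N → Fin K → Channel M) (F : Beamformer M K) : ℝ :=
  (1 / (N : ℝ)) * ∑ k, ∑ n,
    v k * (rate P ρ k (H k + φ n k) F + P.γ k * harvested P ρ k (H k + φ n k) F)

/-- `F` is a (first order) stationary point of the problem of maximizing `f` over the convex set
`C`, where `ℂ^{M × K}` is viewed as a real vector space. -/
def IsStationary (f : Beamformer M K → ℝ) (C : Set (Beamformer M K)) (F : Beamformer M K) : Prop :=
  F ∈ C ∧ ∃ f' : Beamformer M K →L[ℝ] ℝ, HasFDerivAt f f' F ∧ ∀ G ∈ C, f' (G - F) ≤ 0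

/-- The set `F*(ρ, v, Ĥ)` of stationary points of `P₂(ρ, v, Ĥ)`. -/
def stationarySet (P : System M K) (ρ v : Fin K → ℝ) (H : Fin K → Channel M) :
    Set (Beamformer M K) :=
  {F | IsStationary (trueObjective P ρ v H) (feasible P) F}

/-! ### The short-term FP-BCD iteration -/

/-- Total received power of the information decoder, `ρ_k (Γ + σ_k²) + δ_k²`. -/
def decoderPower (P : System M K) (ρ : Fin K → ℝ) (k : Fin K) (h : Channel M)
    (F : Beamformer M K) : ℝ :=
  ρ k * (gain h F + P.σ k ^ 2) + P.δ k ^ 2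

/-- The update of the auxiliary variable `q`. -/
def qUpdate (P : System M K) (ρ : Fin K → ℝ) (k : Fin K) (h : Channel M)
    (F : Beamformer M K) : ℝ :=
  ρ k * ‖inner ℂ h (F k)‖ ^ 2 /
    (ρ k * (gain h F - ‖inner ℂ h (F k)‖ ^ 2 + P.σ k ^ 2) + P.δ k ^ 2)

/-- The update of the auxiliary variable `w`, for a given value of `q`. -/
def wUpdate (P : System M K) (ρ v : Fin K → ℝ) (k : Fin K) (h : Channel M) (q : ℝ)
    (F : Beamformer M K) : ℂ :=
  (((decoderPower P ρ k h F)⁻¹ * Real.sqrt (ρ k * v k * (1 + q)) : ℝ) : ℂ) * inner ℂ h (F k)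

/-- The fractional programming form of the weighted rate `v_k log₂ (1 + SINR_k)`, obtained by the
Lagrangian dual transform (variable `q`) and the complex quadratic transform (variable `w`). -/
def rateFP (P : System M K) (ρ v : Fin K → ℝ) (k : Fin K) (h : Channel M) (q : ℝ) (w : ℂ)
    (F : Beamformer M K) : ℝ :=
  (1 / Real.log 2) *
    (2 * Real.sqrt (ρ k * v k * (1 + q)) * (inner ℂ (F k) h * w).re
      - ‖w‖ ^ 2 * decoderPower P ρ k h F
      + v k * (Real.log (1 + q) - q))

/-- The value `Ψ_k / S_k - Ω_k` at `F` of the auxiliary variable `ς` of the harvested power, so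
that `S_k / (1 - Ω_k) * ς` is the harvested power. -/
def sigmaValue (P : System M K) (ρ : Fin K → ℝ) (k : Fin K) (h : Channel M)
    (F : Beamformer M K) : ℝ :=
  psi P ρ k h F / P.S k - omega P k

/-- The left-hand side of the linearized energy constraint in `(F, ς)`: the first order Taylor
expansion at `(F₀, ς₀)` of `ln (1 / (ς + Ω_k) - 1) + d_k ∑ m, |hᴴ f_m|² + c_k`, where
`d_k = a_k (1 - ρ_k)` and `c_k = a_k σ_k² (1 - ρ_k) - a_k b_k`. -/
def linearizedConstraint (P : System M K) (ρ : Fin K → ℝ) (k : Fin K) (h : Channel M)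
    (F₀ : Beamformer M K) (ς₀ : ℝ) (F : Beamformer M K) (ς : ℝ) : ℝ :=
  P.a k * (1 - ρ k) *
      (∑ m, (‖inner ℂ h (F₀ m)‖ ^ 2
        + 2 * (inner ℂ h (F₀ m) * inner ℂ (F m - F₀ m) h).re))
    + Real.log (1 / (ς₀ + omega P k) - 1)
    + (ς - ς₀) / ((ς₀ + omega P k - 1) * (ς₀ + omega P k))
    + (P.a k * P.σ k ^ 2 * (1 - ρ k) - P.a k * P.b k)

/-- The objective, in `(F, ς)`, of the convex problem of Step 3 after `q` and `w` have been updated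
at the last iterate `F₀`. -/
def stepObjective (P : System M K) (ρ v : Fin K → ℝ) (H : Fin K → Channel M) {N : ℕ}
    (φ : Fin N → Fin K → Channel M) (F₀ F : Beamformer M K) (ς : Fin N → Fin K → ℝ) : ℝ :=
  (1 / (N : ℝ)) * ∑ n, ∑ k,
    (rateFP P ρ v k (H k + φ n k)
        (qUpdate P ρ k (H k + φ n k) F₀)
        (wUpdate P ρ v k (H k + φ n k) (qUpdate P ρ k (H k + φ n k) F₀) F₀) F
      + v k * P.γ k * (P.S k / (1 - omega P k)) * ς n k)

/-- The feasible set, in `(F, ς)`, of the convex problem of Step 3 with last iterate `F₀`. -/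
def stepFeasible (P : System M K) (ρ : Fin K → ℝ) (H : Fin K → Channel M) {N : ℕ}
    (φ : Fin N → Fin K → Channel M) (F₀ : Beamformer M K) :
    Set (Beamformer M K × (Fin N → Fin K → ℝ)) :=
  {x | x.1 ∈ feasible P ∧ (∀ n k, 0 ≤ x.2 n k) ∧
    ∀ n k, 0 ≤ linearizedConstraint P ρ k (H k + φ n k) F₀
      (sigmaValue P ρ k (H k + φ n k) F₀) x.1 (x.2 n k)}

/-- One pass through Steps 1, 2, 3 from `F₀` may produce `(F, ς)`: it solves the convex problem of
Step 3.  (The maximizer need not be unique.) -/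
def IsStep (P : System M K) (ρ v : Fin K → ℝ) (H : Fin K → Channel M) {N : ℕ}
    (φ : Fin N → Fin K → Channel M) (F₀ F : Beamformer M K) (ς : Fin N → Fin K → ℝ) : Prop :=
  (F, ς) ∈ stepFeasible P ρ H φ F₀ ∧
    ∀ x ∈ stepFeasible P ρ H φ F₀,
      stepObjective P ρ v H φ F₀ x.1 x.2 ≤ stepObjective P ρ v H φ F₀ F ς

/-- `Fs` and `ςs` are the iterates of a run of the FP-BCD iteration with the error samples `φ`,
from some feasible starting point. -/
def IsRun (P : System M K) (ρ v : Fin K → ℝ) (H : Fin K → Channel M) {N : ℕ}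
    (φ : Fin N → Fin K → Channel M) (Fs : ℕ → Beamformer M K)
    (ςs : ℕ → Fin N → Fin K → ℝ) : Prop :=
  Fs 0 ∈ feasible P ∧ ∀ j, IsStep P ρ v H φ (Fs j) (Fs (j + 1)) (ςs (j + 1))

/-- The optimal values of Step 3 never exceed the sample average objective at the point found there,
as is the case when the Taylor expansion bounds the energy constraint from below. -/
def IsMinorizing (P : System M K) (ρ v : Fin K → ℝ) (H : Fin K → Channel M) {N : ℕ}
    (φ : Fin N → Fin K → Channel M) (Fs : ℕ → Beamformer M K)
    (ςs : ℕ → Fin N → Fin K → ℝ) : Prop :=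
  ∀ j, stepObjective P ρ v H φ (Fs j) (Fs (j + 1)) (ςs (j + 1)) ≤
    saaObjective P ρ v H φ (Fs (j + 1))

/-- `F` is a limiting point of a run with error samples `φ`: the limit of its beamformers or, if the
run is minorizing, any accumulation point of them. -/
def IsLimitingPoint (P : System M K) (ρ v : Fin K → ℝ) (H : Fin K → Channel M) {N : ℕ}
    (φ : Fin N → Fin K → Channel M) (F : Beamformer M K) : Prop :=
  ∃ (Fs : ℕ → Beamformer M K) (ςs : ℕ → Fin N → Fin K → ℝ), IsRun P ρ v H φ Fs ςs ∧
    (Tendsto Fs atTop (𝓝 F) ∨ (IsMinorizing P ρ v H φ Fs ςs ∧ MapClusterPt F atTop Fs))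

end SWIPT

end

noncomputable section

namespace SWIPT

variable {M K : ℕ}

/-! ### Exponential moments of the channel errors -/

/-! The proof has a deterministic half, a probabilistic half and a compactness argument joining
them.

Deterministic half: every limiting point is stationary for the sample average objective
(`IsLimitingPoint.isStationary`). The linearized energy constraint is an upper bound `sigmaMax` on
ς, so ς can be eliminated and a pass from F₀ maximizes a surrogate L(F₀, ·). This surrogate agrees
with the sample average objective at F₀ in value and derivative (`surrogate_self`,
`hasFDerivAt_surrogate`) and is jointly continuous. Passing to the limit, a limiting point F is a
local maximizer of L(F, ·) on Λ, and the first order condition carries over to the sample average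
objective. The restriction ς ≥ 0 does no harm near F (`sigmaMax_nonneg_eventually`).

Probabilistic half: if F₀ ∈ Λ is not stationary for the true objective, some G ∈ Λ gives a positive
derivative in direction G - F₀. Outside an event of exponentially small probability, the sample
averages of the derivatives in direction G - F remain positive for all F in one neighbourhood of F₀,
so no limiting point lies there (`exists_isExponentiallySmall_isLimitingPoint`). This is Chernoff's
bound applied to the infimum over a small ball (`exists_measure_exists_sum_le_exp`). The exponential
moments exist because the gradients are at most quadratic in the Gaussian channel (`IsTame`).

The points of Λ at distance at least ε from all stationary points form a compact set. Finitely many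
such neighbourhoods cover it, and a union bound concludes. -/

instance isProbabilityMeasure_complexGaussian (s : ℝ≥0) :
    IsProbabilityMeasure (complexGaussian s) :=
  Measure.isProbabilityMeasure_map (by fun_prop)

instance isProbabilityMeasure_channelErrorLaw (M : ℕ) (s : ℝ≥0) :
    IsProbabilityMeasure (channelErrorLaw M s) :=
  Measure.isProbabilityMeasure_map (by fun_prop)

/-- Fernique's theorem on the line; since |z|² = x² + y², the integrand factors over the product
measure. -/
lemma exists_integrable_exp_sq_complexGaussian (s : ℝ≥0) :
    ∃ c : ℝ, 0 < c ∧ Integrable (fun z : ℂ => Real.exp (c * ‖z‖ ^ 2)) (complexGaussian s) := by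
  obtain ⟨c, hc, hint⟩ := IsGaussian.exists_integrable_exp_sq (gaussianReal 0 (s / 2))
  refine ⟨c, hc, ?_⟩
  unfold complexGaussian
  rw [integrable_map_equiv]
  refine (hint.mul_prod hint).congr (ae_of_all _ fun x => ?_)
  have h : ‖Complex.measurableEquivRealProd.symm x‖ ^ 2 = x.1 ^ 2 + x.2 ^ 2 := by
    rw [← Complex.normSq_eq_norm_sq, Complex.normSq_apply]
    simp [Complex.measurableEquivRealProd, pow_two]
  simp only [Function.comp, h, Real.norm_eq_abs, sq_abs, mul_add, Real.exp_add]

lemma exists_integrable_exp_sq_channelErrorLaw (M : ℕ) (s : ℝ≥0) :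
    ∃ c : ℝ, 0 < c ∧
      Integrable (fun φ : Channel M => Real.exp (c * ‖φ‖ ^ 2)) (channelErrorLaw M s) := by
  obtain ⟨c, hc, hint⟩ := exists_integrable_exp_sq_complexGaussian s
  refine ⟨c, hc, ?_⟩
  unfold channelErrorLaw
  rw [integrable_map_equiv]
  refine (Integrable.fintype_prod (ι := Fin M) fun _ => hint).congr (ae_of_all _ fun x => ?_)
  simp only [Function.comp, EuclideanSpace.norm_sq_eq, Finset.mul_sum, Real.exp_sum]
  rfl

/-! ### Large deviations for sample averages -/

section LargeDeviations

variable {Ω : Type*} [MeasurableSpace Ω] {μ : Measure Ω}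

lemma zero_mem_interior_integrableExpSet {E : Type*} [MeasurableSpace E] {ν : Measure E}
    {Y : E → ℝ} (hY : Measurable Y) {c : ℝ} (hc : 0 < c)
    (hint : Integrable (fun x => Real.exp (c * |Y x|)) ν) :
    (0 : ℝ) ∈ interior (integrableExpSet Y ν) := by
  rw [mem_interior_iff_mem_nhds]
  filter_upwards [Ioo_mem_nhds (neg_lt_zero.2 hc) hc] with t ht
  refine hint.mono' (by fun_prop) (ae_of_all _ fun x => ?_)
  rw [Real.norm_eq_abs, Real.abs_exp, Real.exp_le_exp]
  calc t * Y x ≤ |t| * |Y x| := by rw [← abs_mul]; exact le_abs_self _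
    _ ≤ c * |Y x| := by gcongr; exact (abs_lt.2 ht).le

/-- Chernoff's bound for the lower tail of a sample average. -/
lemma exists_measure_sum_le_exp {E : Type*} [MeasurableSpace E] {ν : Measure E}
    [IsProbabilityMeasure ν] [IsProbabilityMeasure μ] {ξ : ℕ → Ω → E}
    (hlaw : ∀ n, HasLaw (ξ n) ν μ) (hind : iIndepFun ξ μ) {Y : E → ℝ} (hY : Measurable Y)
    {c : ℝ} (hc : 0 < c) (hint : Integrable (fun x => Real.exp (c * |Y x|)) ν)
    {m : ℝ} (hm : m < ∫ x, Y x ∂ν) :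
    ∃ b : ℝ, 0 < b ∧ ∀ N : ℕ, μ {ω | ∑ n : Fin N, Y (ξ n ω) ≤ N * m} ≤
      ENNReal.ofReal (Real.exp (-(N : ℝ) * b)) := by
  have h0 := zero_mem_interior_integrableExpSet hY hc hint
  -- The Chernoff factor equals 1 at t = 0 with slope E[Y] - m > 0, so it is below 1 at some t < 0.
  have hder : HasDerivAt (fun t => Real.exp (-t * m) * mgf Y ν t) (∫ x, Y x ∂ν - m) 0 := by
    have h1 : HasDerivAt (fun t : ℝ => Real.exp (-t * m)) (Real.exp (-0 * m) * (-1 * m)) 0 :=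
      ((hasDerivAt_neg (0 : ℝ)).mul_const m).exp
    have h2 := h1.mul (hasDerivAt_mgf h0)
    refine h2.congr_deriv ?_
    simp
    ring
  obtain ⟨t, ht, hlt, hmem⟩ : ∃ t : ℝ, t < 0 ∧ Real.exp (-t * m) * mgf Y ν t < 1 ∧
      t ∈ integrableExpSet Y ν := by
    have hs := (hasDerivAt_iff_tendsto_slope.1 hder).mono_left
      (nhdsWithin_mono (0 : ℝ) (fun x (hx : x ∈ Set.Iio 0) => (Set.mem_Iio.1 hx).ne))
    have hpos := hs.eventually (lt_mem_nhds (sub_pos.2 hm))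
    have hin : ∀ᶠ t in 𝓝[<] (0 : ℝ), t ∈ integrableExpSet Y ν :=
      nhdsWithin_le_nhds (mem_interior_iff_mem_nhds.1 h0)
    obtain ⟨t, ⟨hpt, hti⟩, ht0⟩ := ((hpos.and hin).and self_mem_nhdsWithin).exists
    refine ⟨t, ht0, ?_, hti⟩
    simp only [slope_def_field, neg_zero, zero_mul, Real.exp_zero, mgf_zero, mul_one, sub_zero]
      at hpt
    by_contra! hge
    exact hpt.not_ge (div_nonpos_of_nonneg_of_nonpos (sub_nonneg.2 hge) (Set.mem_Iio.1 ht0).le)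
  set g := Real.exp (-t * m) * mgf Y ν t with hg
  have hgpos : 0 < g := mul_pos (Real.exp_pos _) (mgf_pos hmem)
  refine ⟨-Real.log g, by simpa using Real.log_neg hgpos hlt, fun N => ?_⟩
  have hindY : iIndepFun (fun n => Y ∘ ξ n) μ := hind.comp _ fun _ => hY
  have hmeas : ∀ n, AEMeasurable (Y ∘ ξ n) μ := fun n =>
    hY.comp_aemeasurable (hlaw n).aemeasurable
  have hmgf : ∀ n, mgf (Y ∘ ξ n) μ t = mgf Y ν t := fun n => by
    rw [← (hlaw n).map_eq, mgf_map (hlaw n).aemeasurable (by fun_prop)]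
  have hI : ∀ n, Integrable (fun ω => Real.exp (t * (Y ∘ ξ n) ω)) μ := fun n => by
    have h : Integrable (fun x => Real.exp (t * Y x)) (μ.map (ξ n)) := by
      rw [(hlaw n).map_eq]; exact hmem
    exact h.comp_aemeasurable (hlaw n).aemeasurable
  have hsum : ∀ ω, ∑ n : Fin N, Y (ξ n ω) = (∑ n ∈ Finset.range N, Y ∘ ξ n) ω := fun ω => by
    rw [Finset.sum_apply, Finset.sum_range]; rfl
  -- A moment generating function takes the value 0 where integrability fails; independence makes
  -- this one a product of positive factors.
  have hint : Integrable (fun ω => Real.exp (t * (∑ n ∈ Finset.range N, Y ∘ ξ n) ω)) μ :=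
    mgf_pos_iff.1 <| by
      rw [hindY.mgf_sum₀ hmeas]
      exact Finset.prod_pos fun n _ => mgf_pos (hI n)
  have hle := measure_le_le_exp_mul_mgf (N * m) ht.le hint
  rw [hindY.mgf_sum₀ hmeas, Finset.prod_congr rfl fun n _ => hmgf n, Finset.prod_const,
    Finset.card_range] at hle
  simp_rw [hsum]
  rw [← ofReal_measureReal]
  refine ENNReal.ofReal_le_ofReal (hle.trans_eq ?_)
  rw [show -(N : ℝ) * -Real.log g = N * Real.log g by ring, Real.exp_nat_mul, Real.exp_log hgpos,
    hg, mul_pow, ← Real.exp_nat_mul]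
  congr 2
  ring

/-- Chernoff's bound, uniformly over a small ball of parameters. -/
lemma exists_measure_exists_sum_le_exp {E B : Type*} [NormedAddCommGroup E] [MeasurableSpace E]
    [BorelSpace E] [NormedAddCommGroup B] [ProperSpace B] {ν : Measure E}
    [IsProbabilityMeasure ν] [IsProbabilityMeasure μ] {ξ : ℕ → Ω → E}
    (hlaw : ∀ n, HasLaw (ξ n) ν μ) (hind : iIndepFun ξ μ) {X : E → B → ℝ}
    (hX : Continuous (Function.uncurry X)) {C : ℝ} (F₀ : B)
    (hbound : ∀ h, ∀ F ∈ Metric.closedBall F₀ 1, |X h F| ≤ C * (1 + ‖h‖ ^ 2))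
    {c : ℝ} (hc : 0 < c) (hint : Integrable (fun h => Real.exp (c * ‖h‖ ^ 2)) ν)
    {m : ℝ} (hm : m < ∫ h, X h F₀ ∂ν) :
    ∃ r b : ℝ, 0 < r ∧ 0 < b ∧ ∀ N : ℕ,
      μ {ω | ∃ F ∈ Metric.closedBall F₀ r, ∑ n : Fin N, X (ξ n ω) F ≤ N * m} ≤
        ENNReal.ofReal (Real.exp (-(N : ℝ) * b)) := by
  have hXh : ∀ h, Continuous (X h) := fun h =>
    hX.comp (Continuous.prodMk_right h)
  wlog hC : 0 < C generalizing C
  · refine this (C := 1) (fun h F hF => (hbound h F hF).trans ?_) one_pos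
    gcongr
    linarith
  let R : ℕ → ℝ := fun j => 1 / ((j : ℝ) + 1)
  have hR0 : ∀ j, 0 < R j := fun j => by positivity
  have hR1 : ∀ j, R j ≤ 1 := fun j => by
    simp only [R]; rw [div_le_one (by positivity)]; simp
  -- The infimum over the ball bounds all F in it at once. As the radius shrinks its expectation
  -- tends to that of X(·, F₀) by dominated convergence, hence exceeds m for some j.
  let Z : ℕ → E → ℝ := fun j h => sInf (X h '' Metric.closedBall F₀ (R j))
  have hZmem : ∀ j h, ∃ F ∈ Metric.closedBall F₀ (R j), X h F = Z j h ∧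
      ∀ F' ∈ Metric.closedBall F₀ (R j), Z j h ≤ X h F' := fun j h => by
    obtain ⟨F, hF, hFe, hFmin⟩ := (isCompact_closedBall F₀ (R j)).exists_sInf_image_eq_and_le
      ⟨F₀, Metric.mem_closedBall_self (hR0 j).le⟩ (hXh h).continuousOn
    exact ⟨F, hF, hFe.symm, fun F' hF' => hFe.trans_le (hFmin F' hF')⟩
  have hZcont : ∀ j, Continuous (Z j) := fun j => (isCompact_closedBall F₀ (R j)).continuous_sInf hX
  have hZbound : ∀ j h, |Z j h| ≤ C * (1 + ‖h‖ ^ 2) := fun j h => by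
    obtain ⟨F, hF, hFe, -⟩ := hZmem j h
    rw [← hFe]
    exact hbound h F (Metric.closedBall_subset_closedBall (hR1 j) hF)
  -- The exponent is c + c‖h‖²: the rate c / C compensates for the constant in the quadratic bound.
  have hdom : Integrable (fun h => Real.exp (c / C * (C * (1 + ‖h‖ ^ 2)))) ν := by
    refine (hint.const_mul (Real.exp c)).congr (ae_of_all _ fun h => ?_)
    simp only
    rw [← Real.exp_add]
    congr 1
    field_simp
  have hdom1 : Integrable (fun h : E => C * (1 + ‖h‖ ^ 2)) ν := by
    refine (hdom.const_mul (C / c)).mono' (by fun_prop) (ae_of_all _ fun h => ?_)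
    rw [Real.norm_of_nonneg (by positivity)]
    calc C * (1 + ‖h‖ ^ 2) = C / c * (c / C * (C * (1 + ‖h‖ ^ 2))) := by field_simp
      _ ≤ C / c * Real.exp (c / C * (C * (1 + ‖h‖ ^ 2))) := by
        gcongr
        linarith [Real.add_one_le_exp (c / C * (C * (1 + ‖h‖ ^ 2)))]
  have hlim : Tendsto (fun j => ∫ h, Z j h ∂ν) atTop (𝓝 (∫ h, X h F₀ ∂ν)) := by
    refine tendsto_integral_of_dominated_convergence _
      (fun j => (hZcont j).measurable.aestronglyMeasurable) hdom1
      (fun j => ae_of_all _ fun h => hZbound j h) (ae_of_all _ fun h => ?_)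
    choose F hF hFe _ using fun j => hZmem j h
    have hFlim : Tendsto F atTop (𝓝 F₀) := by
      rw [tendsto_iff_dist_tendsto_zero]
      exact squeeze_zero (fun _ => dist_nonneg) (fun j => Metric.mem_closedBall.1 (hF j))
        tendsto_one_div_add_atTop_nhds_zero_nat
    exact (((hXh h).tendsto F₀).comp hFlim).congr hFe
  obtain ⟨j, hj⟩ := (hlim.eventually (lt_mem_nhds hm)).exists
  obtain ⟨b, hb, hle⟩ := exists_measure_sum_le_exp hlaw hind (hZcont j).measurable
    (c := c / C) (by positivity)
    (hdom.mono' (by have := (hZcont j).measurable; fun_prop) (ae_of_all _ fun h => by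
      rw [Real.norm_eq_abs, Real.abs_exp]
      gcongr
      exact hZbound j h)) hj
  refine ⟨R j, b, hR0 j, hb, fun N => (measure_mono ?_).trans (hle N)⟩
  rintro ω ⟨F, hF, hsum⟩
  refine le_trans (Finset.sum_le_sum fun n _ => ?_) hsum
  obtain ⟨-, -, -, hmin⟩ := hZmem j (ξ n ω)
  exact hmin F hF

end LargeDeviations

/-! ### Functions of the channel and the beamformer with quadratically bounded gradient -/

/-- Functions of a channel and a beamformer that are continuously differentiable, whose gradient in
the beamformer is at most quadratic in the channel, and which do not depend on the channel when
nothing is transmitted. -/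
structure IsTame (u : Channel M → Beamformer M K → ℝ) : Prop where
  contDiff : ContDiff ℝ 1 (Function.uncurry u)
  bound : ∃ C : ℝ, 0 ≤ C ∧ ∀ h F, ‖fderiv ℝ (u h) F‖ ≤ C * ‖h‖ ^ 2 * ‖F‖
  zero : ∀ h, u h 0 = u 0 0

namespace IsTame

variable {u w : Channel M → Beamformer M K → ℝ}

lemma differentiableAt (hu : IsTame u) (h : Channel M) (F : Beamformer M K) :
    DifferentiableAt ℝ (u h) F :=
  ((hu.contDiff.differentiable one_ne_zero).comp
    ((differentiable_const h).prodMk differentiable_id)) F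

lemma continuous_fderiv (hu : IsTame u) :
    Continuous fun p : Channel M × Beamformer M K => fderiv ℝ (u p.1) p.2 := by
  have h : ContDiff ℝ 1 (Function.uncurry fun p : Channel M × Beamformer M K => u p.1) :=
    hu.contDiff.comp ((contDiff_fst.comp contDiff_fst).prodMk contDiff_snd)
  exact (h.fderiv (n := 0) contDiff_snd (by norm_num)).continuous

/-- Mean value inequality from the beamformer 0, where the value does not depend on the channel. -/
lemma abs_le (hu : IsTame u) :
    ∃ C : ℝ, 0 ≤ C ∧ ∀ h F, |u h F| ≤ |u 0 0| + C * ‖h‖ ^ 2 * ‖F‖ ^ 2 := by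
  obtain ⟨C, hC, hbd⟩ := hu.bound
  refine ⟨C, hC, fun h F => ?_⟩
  have hmv := (convex_closedBall (0 : Beamformer M K) ‖F‖).norm_image_sub_le_of_norm_fderiv_le
    (f := u h) (C := C * ‖h‖ ^ 2 * ‖F‖) (fun G _ => hu.differentiableAt h G)
    (fun G hG => (hbd h G).trans (by gcongr; simpa using hG))
    (Metric.mem_closedBall_self (norm_nonneg F)) (y := F) (by simp)
  rw [hu.zero, sub_zero, Real.norm_eq_abs] at hmv
  have := abs_sub_abs_le_abs_sub (u h F) (u 0 0)
  nlinarith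

lemma const (c : ℝ) : IsTame fun (_ : Channel M) (_ : Beamformer M K) => c :=
  ⟨contDiff_const, ⟨0, le_rfl, by simp⟩, fun _ => rfl⟩

lemma add (hu : IsTame u) (hw : IsTame w) : IsTame fun h F => u h F + w h F := by
  obtain ⟨C, hC, hbd⟩ := hu.bound
  obtain ⟨D, hD, hbd'⟩ := hw.bound
  refine ⟨hu.contDiff.add hw.contDiff, ⟨C + D, by positivity, fun h F => ?_⟩, fun h => ?_⟩
  · rw [fderiv_fun_add (hu.differentiableAt h F) (hw.differentiableAt h F)]
    linarith [norm_add_le (fderiv ℝ (u h) F) (fderiv ℝ (w h) F), hbd h F, hbd' h F]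
  · simp only [hu.zero h, hw.zero h]

lemma const_mul (hu : IsTame u) (c : ℝ) : IsTame fun h F => c * u h F := by
  obtain ⟨C, hC, hbd⟩ := hu.bound
  refine ⟨contDiff_const.mul hu.contDiff, ⟨|c| * C, by positivity, fun h F => ?_⟩, fun h => ?_⟩
  · rw [fderiv_const_mul (hu.differentiableAt h F), norm_smul, Real.norm_eq_abs, mul_assoc,
      mul_assoc, ← mul_assoc C]
    gcongr
    exact hbd h F
  · simp only [hu.zero h]

lemma sum {ι : Type*} (s : Finset ι) {u : ι → Channel M → Beamformer M K → ℝ}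
    (hu : ∀ i, IsTame (u i)) : IsTame fun h F => ∑ i ∈ s, u i h F := by
  classical
  induction s using Finset.induction_on with
  | empty => simpa using const 0
  | insert i s hi ih => simpa [Finset.sum_insert hi] using (hu i).add ih

/-- Chain rule. The derivative of g has to be bounded only on the range of u, which admits the
logarithm of functions bounded away from 0. -/
lemma comp (hu : IsTame u) {g : ℝ → ℝ} {L : ℝ} (hL : 0 ≤ L)
    (hg : ∀ h F, ContDiffAt ℝ 1 g (u h F)) (hg' : ∀ h F, |deriv g (u h F)| ≤ L) :
    IsTame fun h F => g (u h F) := by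
  obtain ⟨C, hC, hbd⟩ := hu.bound
  refine ⟨contDiff_iff_contDiffAt.2 fun p => (hg p.1 p.2).comp p hu.contDiff.contDiffAt,
    ⟨L * C, by positivity, fun h F => ?_⟩, fun h => ?_⟩
  · have hd := ((hg h F).differentiableAt one_ne_zero).hasDerivAt.comp_hasFDerivAt F
      (hu.differentiableAt h F).hasFDerivAt
    have hd' : fderiv ℝ (fun F => g (u h F)) F = _ := hd.fderiv
    rw [hd', norm_smul, Real.norm_eq_abs, mul_assoc, mul_assoc, ← mul_assoc C]
    exact mul_le_mul (hg' h F) (hbd h F) (norm_nonneg _) hL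
  · simp only [hu.zero h]

lemma norm_inner_sq (m : Fin K) :
    IsTame fun (h : Channel M) (F : Beamformer M K) => ‖(inner ℂ h (F m) : ℂ)‖ ^ 2 := by
  refine ⟨?_, ⟨2, zero_le_two, fun h F => ?_⟩, fun h => by simp⟩
  · have : ContDiff ℝ 1 fun p : Channel M × Beamformer M K => (inner ℂ p.1 (p.2 m) : ℂ) := by
      refine contDiff_fst.inner ℂ ?_
      exact ((PiLp.proj 2 (fun _ : Fin K => Channel M) m : _ →L[ℝ] _)).contDiff.comp contDiff_snd
    exact this.norm_sq ℝ
  · let ℓ : Beamformer M K →L[ℝ] ℂ := ((innerSL ℂ h).comp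
      (PiLp.proj 2 (fun _ : Fin K => Channel M) m : Beamformer M K →L[ℂ] Channel M)).restrictScalars ℝ
    have hval : ∀ G, ‖ℓ G‖ ≤ ‖h‖ * ‖G‖ := fun G =>
      (norm_inner_le_norm h (G m)).trans (by gcongr; exact PiLp.norm_apply_le G m)
    have hℓ : ‖ℓ‖ ≤ ‖h‖ := ContinuousLinearMap.opNorm_le_bound _ (norm_nonneg h) hval
    have hd : HasFDerivAt (fun G : Beamformer M K => ‖(inner ℂ h (G m) : ℂ)‖ ^ 2) _ F :=
      (ℓ.hasFDerivAt (x := F)).norm_sq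
    rw [hd.fderiv]
    calc ‖(2 : ℕ) • (innerSL ℝ (ℓ F)).comp ℓ‖ ≤ 2 * ‖(innerSL ℝ (ℓ F)).comp ℓ‖ := by
          simpa using norm_nsmul_le (n := 2) (a := (innerSL ℝ (ℓ F)).comp ℓ)
      _ ≤ 2 * (‖innerSL ℝ (ℓ F)‖ * ‖ℓ‖) := by
          gcongr; exact ContinuousLinearMap.opNorm_comp_le _ _
      _ ≤ 2 * ((‖h‖ * ‖F‖) * ‖h‖) := by
          rw [innerSL_apply_norm]; gcongr; exact hval F
      _ = 2 * ‖h‖ ^ 2 * ‖F‖ := by ring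

lemma log_add (hu : IsTame u) (hpos : ∀ h F, 0 ≤ u h F) {c : ℝ} (hc : 0 < c) :
    IsTame fun h F => Real.log (u h F + c) := by
  refine (hu.add (const c)).comp (g := Real.log) (L := c⁻¹) (by positivity) (fun h F => ?_)
    fun h F => ?_
  · exact Real.contDiffAt_log.2 (by linarith [hpos h F])
  · have := hpos h F
    rw [Real.deriv_log, abs_of_nonneg (by positivity)]
    gcongr
    linarith

lemma sigmoid (hu : IsTame u) : IsTame fun h F => Real.sigmoid (u h F) := by
  refine hu.comp zero_le_one (fun h F => contDiff_sigmoid.contDiffAt.of_le le_top) fun h F => ?_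
  simp only [Real.deriv_sigmoid]
  have h1 := Real.sigmoid_nonneg (u h F)
  have h2 := Real.sigmoid_le_one (u h F)
  rw [abs_of_nonneg (by nlinarith)]
  nlinarith

end IsTame

/-! ### The utility of a device -/

/-- The weighted sum of rate and harvested power of device `k`. -/
def utility (P : System M K) (ρ v : Fin K → ℝ) (k : Fin K) (h : Channel M)
    (F : Beamformer M K) : ℝ :=
  v k * (rate P ρ k h F + P.γ k * harvested P ρ k h F)

lemma gain_nonneg (h : Channel M) (F : Beamformer M K) : 0 ≤ gain h F :=
  Finset.sum_nonneg fun _ _ => by positivity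

lemma gain_eq_add_sum_erase (k : Fin K) (h : Channel M) (F : Beamformer M K) :
    gain h F = ‖(inner ℂ h (F k) : ℂ)‖ ^ 2 +
      ∑ m ∈ Finset.univ.erase k, ‖(inner ℂ h (F m) : ℂ)‖ ^ 2 :=
  (Finset.add_sum_erase _ _ (Finset.mem_univ k)).symm

lemma isTame_gain : IsTame (gain : Channel M → Beamformer M K → ℝ) :=
  IsTame.sum _ IsTame.norm_inner_sq

section

variable (P : System M K) (ρ : Fin K → ℝ) (k : Fin K) (h : Channel M) (F : Beamformer M K)

/-- Interference plus noise power at the information decoder. -/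
def interference : ℝ :=
  ρ k * ((∑ m ∈ Finset.univ.erase k, ‖(inner ℂ h (F m) : ℂ)‖ ^ 2) + P.σ k ^ 2) + P.δ k ^ 2

lemma interference_pos {ρ : Fin K → ℝ} (hρ : 0 ≤ ρ k) : 0 < interference P ρ k h F := by
  have := P.δ_pos k
  unfold interference
  positivity

lemma decoderPower_eq : decoderPower P ρ k h F =
    ρ k * ‖(inner ℂ h (F k) : ℂ)‖ ^ 2 + interference P ρ k h F := by
  rw [decoderPower, interference, gain_eq_add_sum_erase k]
  ring

lemma decoderPower_pos {ρ : Fin K → ℝ} (hρ : 0 ≤ ρ k) : 0 < decoderPower P ρ k h F := by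
  rw [decoderPower_eq]
  have := interference_pos P k h F hρ
  positivity

/-- As 1 + SINR is total power over interference, the rate is a difference of two logarithms, both
of quantities bounded below by δ_k² > 0. -/
lemma rate_eq {ρ : Fin K → ℝ} (hρ : 0 ≤ ρ k) : rate P ρ k h F =
    (1 / Real.log 2) *
      (Real.log (decoderPower P ρ k h F) - Real.log (interference P ρ k h F)) := by
  have hI := interference_pos P k h F hρ
  have hD := decoderPower_pos P k h F hρ
  rw [← Real.log_div hD.ne' hI.ne', rate, Real.logb, div_eq_mul_inv, mul_comm, one_div]
  congr 2
  rw [decoderPower_eq, add_div, div_self hI.ne', add_comm]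
  rfl

lemma omega_eq_sigmoid : omega P k = Real.sigmoid (-(P.a k * P.b k)) := by
  simp [omega, Real.sigmoid_def]

lemma one_sub_omega_pos : 0 < 1 - omega P k := by
  rw [omega_eq_sigmoid]
  linarith [Real.sigmoid_lt_one (-(P.a k * P.b k))]

lemma psi_eq_sigmoid :
    psi P ρ k h F = P.S k * Real.sigmoid (P.a k * (inputPower P ρ k h F - P.b k)) := by
  rw [psi, Real.sigmoid_def, div_eq_mul_inv, neg_mul]

lemma isTame_rate {ρ : Fin K → ℝ} (hρ : 0 ≤ ρ k) : IsTame (rate P ρ k) := by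
  have hδ := P.δ_pos k
  have h1 := ((isTame_gain (M := M) (K := K)).add (IsTame.const (P.σ k ^ 2))).const_mul (ρ k)
  have h2 := ((IsTame.sum (Finset.univ.erase k) (IsTame.norm_inner_sq (M := M))).add
    (IsTame.const (P.σ k ^ 2))).const_mul (ρ k)
  have h3 := h1.log_add (fun h F => by have := gain_nonneg h F; positivity) (pow_pos hδ 2)
  have h4 := h2.log_add (fun h F => by positivity) (pow_pos hδ 2)
  have h5 := (h3.add (h4.const_mul (-1))).const_mul (1 / Real.log 2)
  convert h5 using 3 with h F
  rw [rate_eq P k h F hρ]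
  simp only [decoderPower, interference]
  ring

lemma isTame_harvested : IsTame (harvested P ρ k) := by
  have h2 := ((((isTame_gain (M := M) (K := K)).add (IsTame.const (P.σ k ^ 2))).const_mul
    (P.a k * (1 - ρ k))).add (IsTame.const (-(P.a k * P.b k)))).sigmoid
  have h3 := ((h2.const_mul (P.S k)).add (IsTame.const (-(P.S k * omega P k)))).const_mul
    (1 / (1 - omega P k))
  convert h3 using 3 with h F
  rw [harvested, psi_eq_sigmoid, div_eq_mul_inv, mul_comm, one_div]
  congr 1
  rw [← sub_eq_add_neg]
  congr 3
  rw [inputPower]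
  ring

lemma isTame_utility {ρ : Fin K → ℝ} (v : Fin K → ℝ) (hρ : 0 ≤ ρ k) :
    IsTame (utility P ρ v k) :=
  ((isTame_rate P k hρ).add ((isTame_harvested P ρ k).const_mul (P.γ k))).const_mul (v k)

end

/-- Value and gradient grow at most quadratically in the channel, locally uniformly in F, so a
finite second moment dominates both. -/
lemma IsTame.hasFDerivAt_integral {u : Channel M → Beamformer M K → ℝ} (hu : IsTame u)
    {ν : Measure (Channel M)} [IsProbabilityMeasure ν]
    (hν : Integrable (fun h => ‖h‖ ^ 2) ν) (h₀ : Channel M) (F : Beamformer M K) :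
    Integrable (fun φ => u (h₀ + φ) F) ν ∧
      Integrable (fun φ => fderiv ℝ (u (h₀ + φ)) F) ν ∧
      HasFDerivAt (fun F => ∫ φ, u (h₀ + φ) F ∂ν) (∫ φ, fderiv ℝ (u (h₀ + φ)) F ∂ν) F := by
  have hsq : ∀ φ : Channel M, ‖h₀ + φ‖ ^ 2 ≤ 2 * ‖h₀‖ ^ 2 + 2 * ‖φ‖ ^ 2 := fun φ => by
    have h1 : ‖h₀ + φ‖ ^ 2 ≤ (‖h₀‖ + ‖φ‖) ^ 2 := by gcongr; exact norm_add_le _ _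
    nlinarith [sq_nonneg (‖h₀‖ - ‖φ‖)]
  have hint : ∀ A B : ℝ, Integrable (fun φ => A + B * (2 * ‖h₀‖ ^ 2 + 2 * ‖φ‖ ^ 2)) ν :=
    fun A B => (integrable_const A).add (((integrable_const _).add (hν.const_mul 2)).const_mul B)
  have hmeas : ∀ G, AEStronglyMeasurable (fun φ => u (h₀ + φ) G) ν := fun G => by
    have := hu.contDiff.continuous
    have h' : Continuous fun φ => Function.uncurry u (h₀ + φ, G) := by fun_prop
    exact h'.aestronglyMeasurable
  have hmeas' : AEStronglyMeasurable (fun φ => fderiv ℝ (u (h₀ + φ)) F) ν := by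
    have h' : Continuous fun φ => fderiv ℝ (u (h₀ + φ)) F :=
      hu.continuous_fderiv.comp (g := fun p : Channel M × Beamformer M K => fderiv ℝ (u p.1) p.2)
        (f := fun φ => (h₀ + φ, F)) (by fun_prop)
    exact h'.aestronglyMeasurable
  obtain ⟨C, hC, hbd⟩ := hu.bound
  obtain ⟨D, hD, habs⟩ := hu.abs_le
  have hI : Integrable (fun φ => u (h₀ + φ) F) ν := by
    refine (hint |u 0 0| (D * ‖F‖ ^ 2)).mono' (hmeas F) (ae_of_all _ fun φ => ?_)
    refine (habs _ _).trans ?_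
    nlinarith [mul_le_mul_of_nonneg_left (hsq φ) (show 0 ≤ D * ‖F‖ ^ 2 by positivity)]
  have hbound : ∀ φ, ∀ G ∈ Metric.ball F 1, ‖fderiv ℝ (u (h₀ + φ)) G‖ ≤
      0 + (C * (‖F‖ + 1)) * (2 * ‖h₀‖ ^ 2 + 2 * ‖φ‖ ^ 2) := fun φ G hG => by
    have hG' : ‖G‖ ≤ ‖F‖ + 1 := by
      have := norm_le_norm_add_norm_sub' G F
      rw [mem_ball_iff_norm] at hG
      linarith
    calc ‖fderiv ℝ (u (h₀ + φ)) G‖ ≤ C * ‖h₀ + φ‖ ^ 2 * ‖G‖ := hbd _ _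
      _ ≤ C * (2 * ‖h₀‖ ^ 2 + 2 * ‖φ‖ ^ 2) * (‖F‖ + 1) := by gcongr; exact hsq φ
      _ = _ := by ring
  refine ⟨hI, (hint 0 (C * (‖F‖ + 1))).mono' hmeas' (ae_of_all _ fun φ =>
    hbound φ F (Metric.mem_ball_self one_pos)), ?_⟩
  exact hasFDerivAt_integral_of_dominated_of_fderiv_le (F' := fun G φ => fderiv ℝ (u (h₀ + φ)) G)
    (Metric.ball_mem_nhds F one_pos) (Eventually.of_forall hmeas) hI hmeas'
    (ae_of_all _ hbound) (hint 0 _)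
    (ae_of_all _ fun φ G _ => (hu.differentiableAt _ _).hasFDerivAt)

/-! ### The convex surrogate of the utility of a device -/

section Surrogate

variable (P : System M K) (ρ v : Fin K → ℝ) (k : Fin K) (h : Channel M) (F₀ F : Beamformer M K)

/-- The exponent of the logistic function in the energy harvester. -/
def logisticArg : ℝ := P.a k * (inputPower P ρ k h F - P.b k)

/-- The linear term of the Taylor expansion of the gain at `F₀`. -/
def gainLinear : ℝ := ∑ m, 2 * ((inner ℂ h (F₀ m) : ℂ) * inner ℂ (F m - F₀ m) h).re

/-- The largest `ς` which the linearized energy constraint at `F₀` allows at `F`. -/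
def sigmaMax : ℝ :=
  sigmaValue P ρ k h F₀ +
    Real.sigmoid (logisticArg P ρ k h F₀) * (1 - Real.sigmoid (logisticArg P ρ k h F₀)) *
      (P.a k * (1 - ρ k) * gainLinear h F₀ F)

/-- The fractional programming form of the weighted rate with the auxiliary variables updated at
`F₀`. -/
def rateSurrogate : ℝ :=
  rateFP P ρ v k h (qUpdate P ρ k h F₀) (wUpdate P ρ v k h (qUpdate P ρ k h F₀) F₀) F

/-- The surrogate of the utility of device `k` at the last iterate `F₀`. -/
def utilitySurrogate : ℝ :=
  rateSurrogate P ρ v k h F₀ F +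
    v k * P.γ k * (P.S k / (1 - omega P k)) * sigmaMax P ρ k h F₀ F

/-! ### Solving the linearized energy constraint for ς -/

lemma sigmaValue_eq : sigmaValue P ρ k h F =
    Real.sigmoid (logisticArg P ρ k h F) - omega P k := by
  rw [sigmaValue, psi_eq_sigmoid, mul_div_cancel_left₀ _ (P.S_pos k).ne', logisticArg]

lemma harvested_eq : harvested P ρ k h F =
    P.S k / (1 - omega P k) * sigmaValue P ρ k h F := by
  have := P.S_pos k
  rw [harvested, sigmaValue]
  field_simp

/-- With x the exponent at F₀, one has ς₀ + Ω = sigmoid x and ln(1 / sigmoid x - 1) = -x. The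
original constraint is therefore tight at (F₀, ς₀), the constants cancel, and the slope in ς is -1 /
sigmoid'(x). -/
lemma linearizedConstraint_eq (ς : ℝ) :
    linearizedConstraint P ρ k h F₀ (sigmaValue P ρ k h F₀) F ς =
      (sigmaMax P ρ k h F₀ F - ς) / (Real.sigmoid (logisticArg P ρ k h F₀) *
        (1 - Real.sigmoid (logisticArg P ρ k h F₀))) := by
  set x := logisticArg P ρ k h F₀ with hx
  have h0 : 0 < Real.sigmoid x := Real.sigmoid_pos x
  have h1 : 0 < 1 - Real.sigmoid x := sub_pos.2 (Real.sigmoid_lt_one x)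
  have hs : sigmaValue P ρ k h F₀ + omega P k = Real.sigmoid x := by rw [sigmaValue_eq]; ring
  have hlog : Real.log (1 / Real.sigmoid x - 1) = -x := by
    rw [one_div, Real.sigmoid_def, inv_inv, add_sub_cancel_left, Real.log_exp]
  have hx' : x = P.a k * (1 - ρ k) * gain h F₀ +
      (P.a k * P.σ k ^ 2 * (1 - ρ k) - P.a k * P.b k) := by
    rw [hx, logisticArg, inputPower]; ring
  rw [linearizedConstraint, hs, hlog, Finset.sum_add_distrib, sigmaMax, ← hx]
  change P.a k * (1 - ρ k) * (gain h F₀ + gainLinear h F₀ F) + _ + _ + _ = _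
  rw [add_sub_right_comm, add_div, mul_div_cancel_left₀ _ (mul_pos h0 h1).ne',
    show Real.sigmoid x - 1 = -(1 - Real.sigmoid x) by ring, neg_mul, div_neg, mul_comm (1 - _),
    ← neg_div, neg_sub]
  linarith

lemma linearizedConstraint_nonneg_iff (ς : ℝ) :
    0 ≤ linearizedConstraint P ρ k h F₀ (sigmaValue P ρ k h F₀) F ς ↔
      ς ≤ sigmaMax P ρ k h F₀ F := by
  rw [linearizedConstraint_eq, le_div_iff₀ (mul_pos (Real.sigmoid_pos _)
    (sub_pos.2 (Real.sigmoid_lt_one _))), zero_mul, sub_nonneg]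

/-- The gain is a quadratic form, hence equal to its second order expansion. -/
lemma gainLinear_eq : gainLinear h F₀ F = gain h F - gain h F₀ - gain h (F - F₀) := by
  simp only [gainLinear, gain, ← Finset.sum_sub_distrib]
  refine Finset.sum_congr rfl fun m _ => ?_
  have h1 : (inner ℂ h (F m) : ℂ) = inner ℂ h (F₀ m) + inner ℂ h (F m - F₀ m) := by
    rw [← inner_add_right, add_sub_cancel]
  rw [← inner_conj_symm (F m - F₀ m) h, h1, PiLp.sub_apply]
  simp only [← Complex.normSq_eq_norm_sq, Complex.normSq_apply, Complex.add_re, Complex.add_im,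
    Complex.mul_re, Complex.conj_re, Complex.conj_im]
  ring

lemma gainLinear_self : gainLinear h F F = 0 := by simp [gainLinear]

lemma sigmaMax_self : sigmaMax P ρ k h F F = sigmaValue P ρ k h F := by
  simp [sigmaMax, gainLinear_self]

/-! ### The fractional programming minorant and its tangency -/

variable {ρ v}

lemma one_add_qUpdate (hρ : 0 ≤ ρ k) : 1 + qUpdate P ρ k h F =
    decoderPower P ρ k h F / interference P ρ k h F := by
  have hI := interference_pos P k h F hρ
  rw [qUpdate, gain_eq_add_sum_erase k, add_sub_cancel_left, decoderPower_eq, add_div,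
    div_self hI.ne', add_comm]
  rfl

lemma one_add_qUpdate_pos (hρ : 0 ≤ ρ k) : 0 < 1 + qUpdate P ρ k h F := by
  rw [one_add_qUpdate P k h F hρ]
  exact div_pos (decoderPower_pos P k h F hρ) (interference_pos P k h F hρ)

/-- Two elementary inequalities: completing the square removes w, and ln t ≤ t - 1 at t = (1 + q) I
/ B removes q, where B is the total and I the interference power. -/
lemma rateFP_le (hρ : 0 ≤ ρ k) (hv : 0 ≤ v k) {q : ℝ} (hq : 0 < 1 + q) (w : ℂ) :
    rateFP P ρ v k h q w F ≤ v k * rate P ρ k h F := by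
  have hB := decoderPower_pos P k h F hρ
  have hI := interference_pos P k h F hρ
  have hBI := decoderPower_eq P ρ k h F
  rw [rate_eq P k h F hρ, rateFP, mul_left_comm]
  refine mul_le_mul_of_nonneg_left ?_ (one_div_nonneg.2 (Real.log_nonneg one_le_two))
  set B := decoderPower P ρ k h F
  set I := interference P ρ k h F
  set c := Real.sqrt (ρ k * v k * (1 + q))
  set a := ‖(inner ℂ h (F k) : ℂ)‖
  have hc0 : 0 ≤ c := Real.sqrt_nonneg _
  have hc : c ^ 2 = ρ k * v k * (1 + q) := Real.sq_sqrt (by positivity)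
  have hre : ((inner ℂ (F k) h : ℂ) * w).re ≤ a * ‖w‖ := by
    refine (Complex.re_le_norm _).trans_eq ?_
    rw [norm_mul, norm_inner_symm]
  have hquad : 2 * c * (a * ‖w‖) - ‖w‖ ^ 2 * B ≤ c ^ 2 * a ^ 2 / B := by
    rw [le_div_iff₀ hB]
    nlinarith [sq_nonneg (‖w‖ * B - c * a)]
  have hfrac : c ^ 2 * a ^ 2 / B = v k * ((1 + q) - (1 + q) * I / B) := by
    rw [hc]
    field_simp
    rw [hBI]
    ring
  have hlog : Real.log (1 + q) + Real.log I - Real.log B ≤ (1 + q) * I / B - 1 := by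
    rw [← Real.log_mul hq.ne' hI.ne', ← Real.log_div (by positivity) hB.ne']
    exact Real.log_le_sub_one_of_pos (by positivity)
  nlinarith [mul_le_mul_of_nonneg_left hlog hv, mul_le_mul_of_nonneg_left hre hc0]

/-- The updates 1 + q = B / I and w = c (hᴴ f_k) / B are the equality cases of the two inequalities
behind `rateFP_le`. -/
lemma rateSurrogate_self (hρ : 0 ≤ ρ k) (hv : 0 ≤ v k) :
    rateSurrogate P ρ v k h F F = v k * rate P ρ k h F := by
  have hB := decoderPower_pos P k h F hρ
  have hI := interference_pos P k h F hρ
  have hBI := decoderPower_eq P ρ k h F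
  have hq := one_add_qUpdate P k h F hρ
  have hqpos := one_add_qUpdate_pos P k h F hρ
  rw [rate_eq P k h F hρ, rateSurrogate, rateFP, wUpdate, mul_left_comm (v k)]
  congr 1
  set q := qUpdate P ρ k h F
  set B := decoderPower P ρ k h F
  set I := interference P ρ k h F
  set c := Real.sqrt (ρ k * v k * (1 + q))
  have hc : c ^ 2 = ρ k * v k * (1 + q) := Real.sq_sqrt (by positivity)
  have hre : ((inner ℂ (F k) h : ℂ) * (((B⁻¹ * c : ℝ) : ℂ) * inner ℂ h (F k))).re =
      B⁻¹ * c * ‖(inner ℂ h (F k) : ℂ)‖ ^ 2 := by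
    rw [mul_left_comm, ← inner_conj_symm (F k) h, Complex.re_ofReal_mul, mul_comm (starRingEnd ℂ _),
      Complex.mul_conj, Complex.ofReal_re, Complex.normSq_eq_norm_sq]
  have hw : ‖((B⁻¹ * c : ℝ) : ℂ) * inner ℂ h (F k)‖ ^ 2 =
      (B⁻¹ * c) ^ 2 * ‖(inner ℂ h (F k) : ℂ)‖ ^ 2 := by
    rw [norm_mul, mul_pow, Complex.norm_real, Real.norm_eq_abs, sq_abs]
  rw [hre, hw, ← Real.log_div hB.ne' hI.ne', ← hq]
  have hq' : q = B / I - 1 := by linarith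
  have key : 2 * c * (B⁻¹ * c * ‖(inner ℂ h (F k) : ℂ)‖ ^ 2) -
      (B⁻¹ * c) ^ 2 * ‖(inner ℂ h (F k) : ℂ)‖ ^ 2 * B = v k * q := by
    have : ρ k * ‖(inner ℂ h (F k) : ℂ)‖ ^ 2 = B - I := by linarith
    calc _ = c ^ 2 * ‖(inner ℂ h (F k) : ℂ)‖ ^ 2 / B := by field_simp; ring
      _ = v k * (1 + q) * (ρ k * ‖(inner ℂ h (F k) : ℂ)‖ ^ 2) / B := by rw [hc]; ring
      _ = v k * q := by rw [this, hq, hq']; field_simp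
  rw [key]
  ring

lemma utilitySurrogate_self (hρ : 0 ≤ ρ k) (hv : 0 ≤ v k) :
    utilitySurrogate P ρ v k h F F = utility P ρ v k h F := by
  rw [utilitySurrogate, rateSurrogate_self P k h F hρ hv, sigmaMax_self, utility, harvested_eq]
  ring

/-- A minorant that touches at F₀ has the same derivative there, because the difference has a
minimum at F₀. -/
lemma hasFDerivAt_rateSurrogate (hρ : 0 ≤ ρ k) (hv : 0 ≤ v k) :
    HasFDerivAt (rateSurrogate P ρ v k h F₀) (v k • fderiv ℝ (rate P ρ k h) F₀) F₀ := by
  have hrate := ((isTame_rate P k hρ).differentiableAt h F₀).hasFDerivAt.const_mul (v k)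
  have hdiff : DifferentiableAt ℝ (rateSurrogate P ρ v k h F₀) F₀ := by
    have h1 : DifferentiableAt ℝ (fun F : Beamformer M K => (inner ℂ (F k) h : ℂ)) F₀ := by
      refine DifferentiableAt.inner ℂ ?_ (differentiableAt_const h)
      exact ((PiLp.proj 2 (fun _ : Fin K => Channel M) k : _ →L[ℝ] _)).differentiableAt
    have h2 : DifferentiableAt ℝ (decoderPower P ρ k h) F₀ :=
      (((isTame_gain.differentiableAt h F₀).add_const _).const_mul _).add_const _
    unfold rateSurrogate rateFP
    have h3 : ∀ w : ℂ, DifferentiableAt ℝ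
        (fun F : Beamformer M K => ((inner ℂ (F k) h : ℂ) * w).re) F₀ := fun w =>
      Complex.reCLM.differentiableAt.comp F₀ (h1.mul_const w)
    exact ((((h3 _).const_mul _).sub (h2.const_mul _)).add_const _).const_mul _
  have hmin : IsLocalMin (fun F => v k * rate P ρ k h F - rateSurrogate P ρ v k h F₀ F) F₀ :=
    Eventually.of_forall fun F => by
      simp only [rateSurrogate_self P k h F₀ hρ hv, sub_self]
      exact sub_nonneg.2 (rateFP_le P k h F hρ hv (one_add_qUpdate_pos P k h F₀ hρ) _)
  have h0 := hmin.hasFDerivAt_eq_zero (hrate.sub hdiff.hasFDerivAt)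
  rw [sub_eq_zero.1 h0]
  exact hdiff.hasFDerivAt

lemma hasFDerivAt_gainLinear :
    HasFDerivAt (gainLinear h F₀) (fderiv ℝ (gain h) F₀) F₀ := by
  have hg := (isTame_gain.differentiableAt h F₀).hasFDerivAt
  -- The quadratic remainder is nonnegative and vanishes at F₀.
  have hz : HasFDerivAt (fun F => gain h (F - F₀)) (0 : Beamformer M K →L[ℝ] ℝ) F₀ := by
    have hd : DifferentiableAt ℝ (fun F => gain h (F - F₀)) F₀ :=
      DifferentiableAt.comp (g := gain h) (f := fun F => F - F₀) F₀
        (isTame_gain.differentiableAt h (F₀ - F₀)) (differentiableAt_id.sub_const F₀)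
    have hmin : IsLocalMin (fun F => gain h (F - F₀)) F₀ := Eventually.of_forall fun F => by
      simpa [gain] using gain_nonneg h (F - F₀)
    have := hd.hasFDerivAt
    rwa [hmin.hasFDerivAt_eq_zero this] at this
  have := (hg.sub_const (gain h F₀)).sub hz
  rw [sub_zero] at this
  exact this.congr_of_eventuallyEq (Eventually.of_forall (gainLinear_eq h F₀))

lemma hasFDerivAt_sigmaMax :
    HasFDerivAt (sigmaMax P ρ k h F₀) (fderiv ℝ (sigmaValue P ρ k h) F₀) F₀ := by
  have hg := (isTame_gain.differentiableAt h F₀).hasFDerivAt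
  have harg : HasFDerivAt (logisticArg P ρ k h)
      (P.a k • (1 - ρ k) • fderiv ℝ (gain h) F₀) F₀ :=
    (((hg.add_const _).const_mul _).sub_const _).const_mul _
  have hval := ((Real.hasDerivAt_sigmoid _).comp_hasFDerivAt F₀ harg).sub_const (omega P k)
  have hval' : HasFDerivAt (sigmaValue P ρ k h) _ F₀ :=
    hval.congr_of_eventuallyEq (Eventually.of_forall (sigmaValue_eq P ρ k h))
  rw [hval'.fderiv, smul_smul (P.a k)]
  exact (((hasFDerivAt_gainLinear h F₀).const_mul _).const_mul _).const_add _

lemma hasFDerivAt_utilitySurrogate (hρ : 0 ≤ ρ k) (hv : 0 ≤ v k) :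
    HasFDerivAt (utilitySurrogate P ρ v k h F₀) (fderiv ℝ (utility P ρ v k h) F₀) F₀ := by
  have hs : DifferentiableAt ℝ (sigmaValue P ρ k h) F₀ := by
    have h1 := (isTame_harvested P ρ k).differentiableAt h F₀
    have h2 : sigmaValue P ρ k h =
        fun F => (P.S k / (1 - omega P k))⁻¹ * harvested P ρ k h F := by
      funext F
      have := P.S_pos k
      have := one_sub_omega_pos P k
      rw [harvested_eq, inv_mul_cancel_left₀ (by positivity)]
    rw [h2]
    exact h1.const_mul _
  have hU : HasFDerivAt (utility P ρ v k h) (v k • fderiv ℝ (rate P ρ k h) F₀ +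
      (v k * P.γ k * (P.S k / (1 - omega P k))) • fderiv ℝ (sigmaValue P ρ k h) F₀) F₀ := by
    refine ((((isTame_rate P k hρ).differentiableAt h F₀).hasFDerivAt.const_mul (v k)).add
      (hs.hasFDerivAt.const_mul _)).congr_of_eventuallyEq (Eventually.of_forall fun F => ?_)
    simp only [utility, harvested_eq, Pi.add_apply]
    ring
  rw [hU.fderiv]
  exact (hasFDerivAt_rateSurrogate P k h F₀ hρ hv).add
    ((hasFDerivAt_sigmaMax P k h F₀).const_mul _)

/-! ### Continuity of the surrogate in both arguments -/

lemma continuous_gain : Continuous (gain h : Beamformer M K → ℝ) := by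
  unfold gain; fun_prop

lemma continuous_interference : Continuous (interference P ρ k h) := by
  unfold interference; fun_prop

lemma continuous_decoderPower : Continuous (decoderPower P ρ k h) := by
  have := continuous_gain (K := K) h
  unfold decoderPower; fun_prop

lemma continuous_qUpdate (hρ : 0 ≤ ρ k) : Continuous (qUpdate P ρ k h) := by
  have : qUpdate P ρ k h = fun F => decoderPower P ρ k h F / interference P ρ k h F - 1 := by
    funext F
    linarith [one_add_qUpdate P k h F hρ]
  rw [this]
  exact ((continuous_decoderPower P k h).div (continuous_interference P k h)
    fun F => (interference_pos P k h F hρ).ne').sub continuous_const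

lemma continuous_sigmaValue : Continuous (sigmaValue P ρ k h) := by
  have h1 := continuous_gain (K := K) h
  have h2 : Continuous (logisticArg P ρ k h) := by unfold logisticArg inputPower; fun_prop
  have h3 : sigmaValue P ρ k h = fun F => Real.sigmoid (logisticArg P ρ k h F) - omega P k :=
    funext (sigmaValue_eq P ρ k h)
  rw [h3]
  exact (h2.sigmoid).sub continuous_const

lemma continuous_sigmaMax :
    Continuous fun p : Beamformer M K × Beamformer M K => sigmaMax P ρ k h p.1 p.2 := by
  have h1 := continuous_gain (K := K) h
  have h2 : Continuous (logisticArg P ρ k h) := by unfold logisticArg inputPower; fun_prop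
  have h3 : Continuous fun F => Real.sigmoid (logisticArg P ρ k h F) := h2.sigmoid
  have h4 := continuous_sigmaValue (ρ := ρ) P k h
  have h5 : Continuous fun p : Beamformer M K × Beamformer M K => gainLinear h p.1 p.2 := by
    simp only [gainLinear_eq]
    fun_prop
  unfold sigmaMax
  fun_prop

lemma continuous_utilitySurrogate (hρ : 0 ≤ ρ k) : Continuous
    fun p : Beamformer M K × Beamformer M K => utilitySurrogate P ρ v k h p.1 p.2 := by
  have h1 := continuous_decoderPower (ρ := ρ) P k h
  have h2 := continuous_qUpdate P k h hρ
  have h3 := continuous_sigmaMax (ρ := ρ) P k h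
  have h4 : Continuous fun F => Real.log (1 + qUpdate P ρ k h F) :=
    (continuous_const.add h2).log fun F => (one_add_qUpdate_pos P k h F hρ).ne'
  have h5 : Continuous fun F => (decoderPower P ρ k h F)⁻¹ :=
    h1.inv₀ fun F => (decoderPower_pos P k h F hρ).ne'
  have h6 : Continuous fun F => wUpdate P ρ v k h (qUpdate P ρ k h F) F := by
    unfold wUpdate
    exact (Complex.continuous_ofReal.comp (by fun_prop)).mul (by fun_prop)
  have h7 : Continuous fun p : Beamformer M K × Beamformer M K =>
      ((inner ℂ (p.2 k) h : ℂ) * wUpdate P ρ v k h (qUpdate P ρ k h p.1) p.1).re :=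
    Complex.continuous_re.comp
      (Continuous.mul (by fun_prop) (h6.comp continuous_fst))
  have h8 : Continuous fun p : Beamformer M K × Beamformer M K =>
      ‖wUpdate P ρ v k h (qUpdate P ρ k h p.1) p.1‖ ^ 2 := (h6.norm.pow 2).comp continuous_fst
  have h9 := h4.comp (continuous_fst (X := Beamformer M K) (Y := Beamformer M K))
  have h10 : Continuous fun p : Beamformer M K × Beamformer M K =>
      2 * Real.sqrt (ρ k * v k * (1 + qUpdate P ρ k h p.1)) := by fun_prop
  exact (continuous_const.mul (((h10.mul h7).sub (h8.mul (h1.comp continuous_snd))).add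
    (continuous_const.mul (h9.sub (h2.comp continuous_fst))))).add (continuous_const.mul h3)

/-- Near the diagonal, ς ≥ 0 excludes no candidate. If ρ_k < 1, the antenna noise σ_k² > 0 alone
makes the value at (F, F) positive, and continuity applies; if ρ_k = 1, nothing is harvested and
`sigmaMax` is identically 0. -/
lemma sigmaMax_nonneg_eventually (hρ : ρ k ∈ Set.Ioc (0 : ℝ) 1) :
    ∀ᶠ p in 𝓝 (F, F), 0 ≤ sigmaMax P ρ k h p.1 p.2 := by
  have hval : ∀ G : Beamformer M K, logisticArg P ρ k h G =
      -(P.a k * P.b k) + P.a k * ((1 - ρ k) * (gain h G + P.σ k ^ 2)) := fun G => by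
    rw [logisticArg, inputPower]; ring
  rcases hρ.2.eq_or_lt with h1 | h1
  · refine Eventually.of_forall fun p => ?_
    simp [sigmaMax, sigmaValue_eq, hval, h1, omega_eq_sigmoid]
  · refine ((continuous_sigmaMax P k h).tendsto (F, F)).eventually (le_mem_nhds ?_)
    rw [sigmaMax_self, sigmaValue_eq, omega_eq_sigmoid, sub_pos, Real.sigmoid_lt_iff, hval,
      lt_add_iff_pos_right]
    have := P.a_pos k
    have := P.σ_pos k
    have := gain_nonneg h F
    have : 0 < 1 - ρ k := sub_pos.2 h1
    positivity

end Surrogate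

/-! ### Limiting points are stationary for the sample average approximation -/

lemma feasible_eq_closedBall (P : System M K) :
    feasible P = Metric.closedBall 0 (Real.sqrt P.Pmax) := by
  ext F
  rw [feasible, Set.mem_ofPred_eq, mem_closedBall_zero_iff, Real.le_sqrt (norm_nonneg _)
    P.Pmax_pos.le, PiLp.norm_sq_eq_of_L2]

lemma convex_feasible (P : System M K) : Convex ℝ (feasible P) := by
  rw [feasible_eq_closedBall]; exact convex_closedBall _ _

lemma isCompact_feasible (P : System M K) : IsCompact (feasible P) := by
  rw [feasible_eq_closedBall]; exact isCompact_closedBall _ _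

section Ascent

variable {B : Type*} [TopologicalSpace B] {L : B → B → ℝ} {S : B → ℝ} {Fs : ℕ → B}
  {val : ℕ → ℝ} {F X : B} {p : B → Prop}

/-- A sequence that maximizes, up to the values `val`, the surrogate `L` at its last element
converges to points where the surrogate is maximal. -/
lemma le_of_tendsto_of_majorant (hL : Continuous fun q : B × B => L q.1 q.2)
    (hself : ∀ F, L F F = S F) (hp : ∀ᶠ F₀ in 𝓝 F, p F₀)
    (hX : ∀ j, p (Fs j) → L (Fs j) X ≤ val j) (hval : ∀ j, val j ≤ L (Fs j) (Fs (j + 1)))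
    (hlim : Tendsto Fs atTop (𝓝 F)) : L F X ≤ S F := by
  rw [← hself]
  have h1 : Tendsto (fun j => L (Fs j) X) atTop (𝓝 (L F X)) :=
    (hL.tendsto (F, X)).comp (hlim.prodMk_nhds tendsto_const_nhds)
  have h2 : Tendsto (fun j => L (Fs j) (Fs (j + 1))) atTop (𝓝 (L F F)) :=
    (hL.tendsto (F, F)).comp (hlim.prodMk_nhds (hlim.comp (tendsto_add_atTop_nat 1)))
  refine le_of_tendsto_of_tendsto h1 h2 ?_
  filter_upwards [hlim.eventually hp] with j hj using (hX j hj).trans (hval j)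

/-- A sequence that maximizes the surrogate `L` of `S` at its last element, and along which `S`
increases at least as the maximal values `val`, accumulates at points where the surrogate is
maximal. -/
lemma le_of_mapClusterPt_of_ascent (hL : Continuous fun q : B × B => L q.1 q.2)
    (hself : ∀ F, L F F = S F) (hp : ∀ᶠ F₀ in 𝓝 F, p F₀)
    (hX : ∀ j, p (Fs j) → L (Fs j) X ≤ val j) (hval : ∀ j, S (Fs j) ≤ val j)
    (hval' : ∀ j, val j ≤ S (Fs (j + 1))) (hcl : MapClusterPt F atTop Fs) : L F X ≤ S F := by
  have hLX : Continuous fun F₀ => L F₀ X := hL.comp (continuous_id.prodMk continuous_const)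
  have hS : Continuous S := (hL.comp (continuous_id.prodMk continuous_id)).congr hself
  have hmono : Monotone fun j => S (Fs j) :=
    monotone_nat_of_le_succ fun j => (hval j).trans (hval' j)
  -- S increases along the sequence, so by continuity its value at a cluster point bounds every
  -- term.
  have hle : ∀ j, S (Fs j) ≤ S F := fun j => by
    by_contra! hlt
    obtain ⟨i, hi, hji⟩ := ((hcl.frequently ((hS.tendsto F).eventually
      (gt_mem_nhds hlt))).and_eventually (eventually_ge_atTop j)).exists
    exact (hmono hji).not_gt hi
  by_contra! hlt
  obtain ⟨j, hj, hj'⟩ := (hcl.frequently (((hLX.tendsto F).eventually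
    (lt_mem_nhds hlt)).and hp)).exists
  exact hj.not_ge ((hX j hj').trans ((hval' j).trans (hle _)))

end Ascent

section LimitingPoints

variable (P : System M K) {ρ v : Fin K → ℝ} (H : Fin K → Channel M) {N : ℕ}
  (φ : Fin N → Fin K → Channel M)

/-- The objective of the convex problem of the iteration, for the largest possible `ς`. -/
def surrogate (ρ v : Fin K → ℝ) (F₀ F : Beamformer M K) : ℝ :=
  (1 / (N : ℝ)) * ∑ n, ∑ k, utilitySurrogate P ρ v k (H k + φ n k) F₀ F

lemma saaObjective_eq (ρ v : Fin K → ℝ) (F : Beamformer M K) : saaObjective P ρ v H φ F =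
    (1 / (N : ℝ)) * ∑ n, ∑ k, utility P ρ v k (H k + φ n k) F := by
  rw [saaObjective, Finset.sum_comm]
  rfl

lemma surrogate_self (hρ : ∀ k, 0 ≤ ρ k) (hv : ∀ k, 0 ≤ v k) (F : Beamformer M K) :
    surrogate P H φ ρ v F F = saaObjective P ρ v H φ F := by
  rw [saaObjective_eq, surrogate]
  simp only [utilitySurrogate_self P _ _ _ (hρ _) (hv _)]

lemma continuous_surrogate (hρ : ∀ k, 0 ≤ ρ k) : Continuous
    fun p : Beamformer M K × Beamformer M K => surrogate P H φ ρ v p.1 p.2 :=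
  continuous_const.mul (continuous_finsetSum _ fun _ _ => continuous_finsetSum _ fun k _ =>
    continuous_utilitySurrogate P k _ (hρ k))

lemma hasFDerivAt_saaObjective (hρ : ∀ k, 0 ≤ ρ k) (F : Beamformer M K) :
    HasFDerivAt (saaObjective P ρ v H φ)
      ((1 / (N : ℝ)) • ∑ n, ∑ k, fderiv ℝ (utility P ρ v k (H k + φ n k)) F) F := by
  rw [funext (saaObjective_eq P H φ ρ v)]
  exact (HasFDerivAt.fun_sum fun _ _ => HasFDerivAt.fun_sum fun k _ =>
    ((isTame_utility P k v (hρ k)).differentiableAt _ _).hasFDerivAt).const_mul _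

lemma hasFDerivAt_surrogate (hρ : ∀ k, 0 ≤ ρ k) (hv : ∀ k, 0 ≤ v k) (F : Beamformer M K) :
    HasFDerivAt (surrogate P H φ ρ v F)
      ((1 / (N : ℝ)) • ∑ n, ∑ k, fderiv ℝ (utility P ρ v k (H k + φ n k)) F) F :=
  (HasFDerivAt.fun_sum fun _ _ => HasFDerivAt.fun_sum fun k _ =>
    hasFDerivAt_utilitySurrogate P k _ F (hρ k) (hv k)).const_mul _

/-- Each ς has a nonnegative weight, so raising it to its upper bound cannot decrease the objective.
-/
lemma stepObjective_le_surrogate (hv : ∀ k, 0 ≤ v k) {F₀ F : Beamformer M K}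
    {ς : Fin N → Fin K → ℝ} (hF : (F, ς) ∈ stepFeasible P ρ H φ F₀) :
    stepObjective P ρ v H φ F₀ F ς ≤ surrogate P H φ ρ v F₀ F := by
  unfold stepObjective surrogate utilitySurrogate rateSurrogate
  refine mul_le_mul_of_nonneg_left (Finset.sum_le_sum fun n _ => Finset.sum_le_sum fun k _ => ?_)
    (by positivity)
  have h1 := (linearizedConstraint_nonneg_iff P ρ k (H k + φ n k) F₀ F (ς n k)).1 (hF.2.2 n k)
  have h2 := one_sub_omega_pos P k
  have h3 := P.S_pos k
  have h4 := P.γ_nonneg k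
  have h5 := hv k
  gcongr

lemma surrogate_le_of_isStep {F₀ F X : Beamformer M K}
    {ς : Fin N → Fin K → ℝ} (hstep : IsStep P ρ v H φ F₀ F ς) (hX : X ∈ feasible P)
    (hpos : ∀ n k, 0 ≤ sigmaMax P ρ k (H k + φ n k) F₀ X) :
    surrogate P H φ ρ v F₀ X ≤ stepObjective P ρ v H φ F₀ F ς :=
  hstep.2 (X, fun n k => sigmaMax P ρ k (H k + φ n k) F₀ X) ⟨hX, hpos, fun n k =>
    (linearizedConstraint_nonneg_iff P ρ k (H k + φ n k) F₀ X _).2 le_rfl⟩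

lemma sigmaMax_self_nonneg (hρ : ∀ k, ρ k ∈ Set.Ioc (0 : ℝ) 1) (k : Fin K) (h : Channel M)
    (F : Beamformer M K) : 0 ≤ sigmaMax P ρ k h F F :=
  (sigmaMax_nonneg_eventually P k h F (hρ k)).self_of_nhds

variable {P H φ}

lemma IsRun.mem_feasible {Fs : ℕ → Beamformer M K} {ςs : ℕ → Fin N → Fin K → ℝ}
    (hrun : IsRun P ρ v H φ Fs ςs) (j : ℕ) : Fs j ∈ feasible P := by
  cases j with
  | zero => exact hrun.1
  | succ j => exact (hrun.2 j).1.1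

/-- The energy part of the surrogate is tangent but in general no minorant, so ascent is not
automatic. A convergent run does not need it, as consecutive iterates merge in the limit; for
accumulation points the minorizing condition supplies it. -/
lemma surrogate_le_saaObjective_of_limit (hρ : ∀ k, ρ k ∈ Set.Ioc (0 : ℝ) 1)
    (hv : ∀ k, 0 ≤ v k) {F X : Beamformer M K} {Fs : ℕ → Beamformer M K}
    {ςs : ℕ → Fin N → Fin K → ℝ} (hrun : IsRun P ρ v H φ Fs ςs)
    (hlim : Tendsto Fs atTop (𝓝 F) ∨ (IsMinorizing P ρ v H φ Fs ςs ∧ MapClusterPt F atTop Fs))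
    (hX : X ∈ feasible P)
    (hpos : ∀ᶠ F₀ in 𝓝 F, ∀ n k, 0 ≤ sigmaMax P ρ k (H k + φ n k) F₀ X) :
    surrogate P H φ ρ v F X ≤ saaObjective P ρ v H φ F := by
  have hρ' : ∀ k, 0 ≤ ρ k := fun k => (hρ k).1.le
  have hstep : ∀ j, (∀ n k, 0 ≤ sigmaMax P ρ k (H k + φ n k) (Fs j) X) →
      surrogate P H φ ρ v (Fs j) X ≤
        stepObjective P ρ v H φ (Fs j) (Fs (j + 1)) (ςs (j + 1)) := fun j =>
    surrogate_le_of_isStep P H φ (hrun.2 j) hX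
  rcases hlim with hlim | ⟨hminor, hcl⟩
  · exact le_of_tendsto_of_majorant (continuous_surrogate P H φ hρ')
      (surrogate_self P H φ hρ' hv) hpos hstep
      (fun j => stepObjective_le_surrogate P H φ hv (hrun.2 j).1) hlim
  · refine le_of_mapClusterPt_of_ascent (continuous_surrogate P H φ hρ')
      (surrogate_self P H φ hρ' hv) hpos hstep (fun j => ?_) hminor hcl
    -- The last iterate itself competes in Step 3, so the optimal value is at least the sample
    -- average objective there.
    rw [← surrogate_self P H φ hρ' hv (Fs j)]
    exact surrogate_le_of_isStep P H φ (hrun.2 j) (hrun.mem_feasible j)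
      fun n k => sigmaMax_self_nonneg P hρ k _ _

lemma IsLimitingPoint.mem_feasible {F : Beamformer M K} (hF : IsLimitingPoint P ρ v H φ F) :
    F ∈ feasible P := by
  obtain ⟨Fs, ςs, hrun, hlim⟩ := hF
  have hcl : MapClusterPt F atTop Fs := hlim.elim Tendsto.mapClusterPt And.right
  exact (isCompact_feasible P).isClosed.mem_of_mapClusterPt hcl
    (Eventually.of_forall hrun.mem_feasible)

lemma IsLimitingPoint.isStationary (hρ : ∀ k, ρ k ∈ Set.Ioc (0 : ℝ) 1) (hv : ∀ k, 0 ≤ v k)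
    {F : Beamformer M K} (hF : IsLimitingPoint P ρ v H φ F) :
    IsStationary (saaObjective P ρ v H φ) (feasible P) F := by
  have hρ' : ∀ k, 0 ≤ ρ k := fun k => (hρ k).1.le
  have hmem := hF.mem_feasible
  obtain ⟨Fs, ςs, hrun, hlim⟩ := hF
  refine ⟨hmem, _, hasFDerivAt_saaObjective P H φ hρ' F, fun G hG => ?_⟩
  have hev : ∀ᶠ p in 𝓝 (F, F), ∀ n k, 0 ≤ sigmaMax P ρ k (H k + φ n k) p.1 p.2 :=
    eventually_all.2 fun n => eventually_all.2 fun k =>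
      sigmaMax_nonneg_eventually P k _ F (hρ k)
  rw [nhds_prod_eq] at hev
  -- A product neighbourhood of (F, F): p constrains the last iterate, q the competitor X.
  obtain ⟨p, hp, q, hq, hpq⟩ := eventually_prod_iff.1 hev
  have hmax : IsLocalMaxOn (surrogate P H φ ρ v F) (feasible P) F := by
    filter_upwards [nhdsWithin_le_nhds hq, self_mem_nhdsWithin] with X hqX hX
    rw [surrogate_self P H φ hρ' hv]
    exact surrogate_le_saaObjective_of_limit hρ hv hrun hlim hX (hp.mono fun F₀ h => hpq h hqX)
  exact hmax.hasFDerivWithinAt_nonpos (hasFDerivAt_surrogate P H φ hρ' hv F).hasFDerivWithinAt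
    (sub_mem_posTangentConeAt_of_segment_subset ((convex_feasible P).segment_subset hmem hG))

end LimitingPoints

/-! ### Exponentially small probabilities -/

section ExponentiallySmall

variable {Ω : Type*} [MeasurableSpace Ω] {μ : Measure Ω}

/-- The probabilities of the events `A N` are eventually at most `a * exp (-N * b)`. -/
def IsExponentiallySmall (μ : Measure Ω) (A : ℕ → Set Ω) : Prop :=
  ∃ a b : ℝ, 0 < a ∧ 0 < b ∧
    ∀ᶠ N : ℕ in atTop, μ (A N) ≤ ENNReal.ofReal (a * Real.exp (-(N : ℝ) * b))

namespace IsExponentiallySmall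

lemma mono {A B : ℕ → Set Ω} (hB : IsExponentiallySmall μ B) (h : ∀ᶠ N in atTop, A N ⊆ B N) :
    IsExponentiallySmall μ A := by
  obtain ⟨a, b, ha, hb, hle⟩ := hB
  refine ⟨a, b, ha, hb, ?_⟩
  filter_upwards [hle, h] with N h1 h2 using (measure_mono h2).trans h1

lemma empty : IsExponentiallySmall μ fun _ => ∅ :=
  ⟨1, 1, one_pos, one_pos, by simp⟩

lemma union {A B : ℕ → Set Ω} (hA : IsExponentiallySmall μ A) (hB : IsExponentiallySmall μ B) :
    IsExponentiallySmall μ fun N => A N ∪ B N := by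
  obtain ⟨a, b, ha, hb, hle⟩ := hA
  obtain ⟨c, d, hc, hd, hle'⟩ := hB
  refine ⟨a + c, min b d, by positivity, lt_min hb hd, ?_⟩
  filter_upwards [hle, hle'] with N h1 h2
  refine (measure_union_le _ _).trans ((add_le_add h1 h2).trans ?_)
  rw [← ENNReal.ofReal_add (by positivity) (by positivity), add_mul]
  refine ENNReal.ofReal_le_ofReal (add_le_add ?_ ?_)
  · exact mul_le_mul_of_nonneg_left (Real.exp_le_exp.2 (mul_le_mul_of_nonpos_left
      (min_le_left b d) (by simp))) ha.le
  · exact mul_le_mul_of_nonneg_left (Real.exp_le_exp.2 (mul_le_mul_of_nonpos_left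
      (min_le_right b d) (by simp))) hc.le

lemma iUnion {ι : Type*} [Finite ι] {A : ι → ℕ → Set Ω}
    (hA : ∀ i, IsExponentiallySmall μ (A i)) :
    IsExponentiallySmall μ fun N => ⋃ i, A i N := by
  classical
  have := Fintype.ofFinite ι
  have h : ∀ s : Finset ι, IsExponentiallySmall μ fun N => ⋃ i ∈ s, A i N := fun s => by
    induction s using Finset.induction_on with
    | empty => simpa using empty
    | insert i s hi ih => simpa [Finset.set_biUnion_insert] using (hA i).union ih
  simpa using h Finset.univ

end IsExponentiallySmall

end ExponentiallySmall

/-! ### Non-stationary points are unlikely to be close to limiting points -/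

section Concentration

variable {P : System M K} {ρ v : Fin K → ℝ} {H : Fin K → Channel M}

lemma integrable_norm_sq_channelErrorLaw (M : ℕ) (s : ℝ≥0) :
    Integrable (fun φ : Channel M => ‖φ‖ ^ 2) (channelErrorLaw M s) := by
  obtain ⟨c, hc, hint⟩ := exists_integrable_exp_sq_channelErrorLaw M s
  refine (hint.const_mul c⁻¹).mono' (by fun_prop) (ae_of_all _ fun φ => ?_)
  rw [Real.norm_of_nonneg (by positivity), ← div_eq_inv_mul, le_div_iff₀ hc]
  linarith [Real.add_one_le_exp (c * ‖φ‖ ^ 2)]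

lemma hasFDerivAt_trueObjective (hρ : ∀ k, 0 ≤ ρ k) (F : Beamformer M K) :
    HasFDerivAt (trueObjective P ρ v H)
      (∑ k, ∫ φ, fderiv ℝ (utility P ρ v k (H k + φ)) F ∂(channelErrorLaw M (P.ω k ^ 2))) F := by
  have heq : trueObjective P ρ v H = fun F =>
      ∑ k, ∫ φ, utility P ρ v k (H k + φ) F ∂(channelErrorLaw M (P.ω k ^ 2)) := by
    funext F
    refine Finset.sum_congr rfl fun k _ => ?_
    have hsq := integrable_norm_sq_channelErrorLaw M (P.ω k ^ 2)
    have h1 := ((isTame_rate P k (hρ k)).hasFDerivAt_integral hsq (H k) F).1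
    have h2 := ((isTame_harvested P ρ k).hasFDerivAt_integral hsq (H k) F).1
    simp only [utility]
    rw [integral_const_mul, integral_add h1 (h2.const_mul _), integral_const_mul]
  rw [heq]
  exact HasFDerivAt.fun_sum fun k _ => ((isTame_utility P k v (hρ k)).hasFDerivAt_integral
    (integrable_norm_sq_channelErrorLaw M (P.ω k ^ 2)) (H k) F).2.2

lemma IsTame.exists_abs_fderiv_le {u : Channel M → Beamformer M K → ℝ} (hu : IsTame u)
    (h₀ : Channel M) (F₀ G : Beamformer M K) :
    ∃ C : ℝ, ∀ h, ∀ F ∈ Metric.closedBall F₀ 1,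
      |fderiv ℝ (u (h₀ + h)) F (G - F)| ≤ C * (1 + ‖h‖ ^ 2) := by
  obtain ⟨C, hC, hbd⟩ := hu.bound
  refine ⟨C * (‖F₀‖ + 1) * (‖G - F₀‖ + 1) * (2 * ‖h₀‖ ^ 2 + 2), fun h F hF => ?_⟩
  rw [mem_closedBall_iff_norm] at hF
  have h1 : ‖F‖ ≤ ‖F₀‖ + 1 := by linarith [norm_le_norm_add_norm_sub' F F₀]
  have h2 : ‖G - F‖ ≤ ‖G - F₀‖ + 1 := by
    have := norm_sub_le (G - F₀) (F - F₀)
    rw [sub_sub_sub_cancel_right] at this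
    linarith
  have h3 : ‖h₀ + h‖ ^ 2 ≤ (2 * ‖h₀‖ ^ 2 + 2) * (1 + ‖h‖ ^ 2) := by
    have h4 : ‖h₀ + h‖ ^ 2 ≤ (‖h₀‖ + ‖h‖) ^ 2 := by gcongr; exact norm_add_le _ _
    nlinarith [sq_nonneg (‖h₀‖ - ‖h‖), sq_nonneg (‖h₀‖ * ‖h‖)]
  calc |fderiv ℝ (u (h₀ + h)) F (G - F)| ≤ ‖fderiv ℝ (u (h₀ + h)) F‖ * ‖G - F‖ :=
        (fderiv ℝ (u (h₀ + h)) F).le_opNorm (G - F)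
    _ ≤ C * ‖h₀ + h‖ ^ 2 * ‖F‖ * ‖G - F‖ := by gcongr; exact hbd _ _
    _ ≤ C * ((2 * ‖h₀‖ ^ 2 + 2) * (1 + ‖h‖ ^ 2)) * (‖F₀‖ + 1) * (‖G - F₀‖ + 1) := by gcongr
    _ = _ := by ring

variable {Ω : Type*} [MeasurableSpace Ω] {μ : Measure Ω} [IsProbabilityMeasure μ]
  {φ : ℕ → Fin K → Ω → Channel M}

/-- Sample averages of the directional derivatives of a utility are, locally uniformly, not much
smaller than the expectation. -/
lemma exists_isExponentiallySmall_sum_fderiv_le (hρ : ∀ k, 0 ≤ ρ k)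
    (hlaw : ∀ n k, HasLaw (φ n k) (channelErrorLaw M (P.ω k ^ 2)) μ)
    (hind : ∀ k, iIndepFun (fun n => φ n k) μ) (k : Fin K) (F₀ G : Beamformer M K) {m : ℝ}
    (hm : m < (∫ h, fderiv ℝ (utility P ρ v k (H k + h)) F₀
      ∂(channelErrorLaw M (P.ω k ^ 2))) (G - F₀)) :
    ∃ U ∈ 𝓝 F₀, IsExponentiallySmall μ fun N => {ω | ∃ F ∈ U,
      ∑ n : Fin N, fderiv ℝ (utility P ρ v k (H k + φ n k ω)) F (G - F) ≤ N * m} := by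
  have hu := isTame_utility P k v (hρ k)
  obtain ⟨C, hbd⟩ := hu.exists_abs_fderiv_le (H k) F₀ G
  obtain ⟨c, hc, hint⟩ := exists_integrable_exp_sq_channelErrorLaw M (P.ω k ^ 2)
  have hcont : Continuous (Function.uncurry fun (h : Channel M) (F : Beamformer M K) =>
      fderiv ℝ (utility P ρ v k (H k + h)) F (G - F)) := by
    have h1 : Continuous fun p : Channel M × Beamformer M K =>
        fderiv ℝ (utility P ρ v k (H k + p.1)) p.2 :=
      hu.continuous_fderiv.comp (f := fun p : Channel M × Beamformer M K => (H k + p.1, p.2))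
        (by fun_prop)
    exact h1.clm_apply (by fun_prop)
  rw [ContinuousLinearMap.integral_apply (hu.hasFDerivAt_integral
    (integrable_norm_sq_channelErrorLaw M (P.ω k ^ 2)) (H k) F₀).2.1] at hm
  obtain ⟨r, b, hr, hb, hle⟩ := exists_measure_exists_sum_le_exp (fun n => hlaw n k) (hind k)
    hcont F₀ hbd hc hint hm
  exact ⟨_, Metric.closedBall_mem_nhds F₀ hr, 1, b, one_pos, hb,
    Eventually.of_forall fun N => by simpa only [one_mul] using hle N⟩

lemma exists_isExponentiallySmall_isLimitingPoint (hρ : ∀ k, ρ k ∈ Set.Ioc (0 : ℝ) 1)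
    (hv : ∀ k, 0 ≤ v k) (hlaw : ∀ n k, HasLaw (φ n k) (channelErrorLaw M (P.ω k ^ 2)) μ)
    (hind : ∀ k, iIndepFun (fun n => φ n k) μ) {F₀ : Beamformer M K} (hF₀ : F₀ ∈ feasible P)
    (hns : F₀ ∉ stationarySet P ρ v H) :
    ∃ U ∈ 𝓝 F₀, IsExponentiallySmall μ fun N => {ω | ∃ F ∈ U,
      IsLimitingPoint P ρ v H (fun (n : Fin N) k => φ n k ω) F} := by
  have hρ' : ∀ k, 0 ≤ ρ k := fun k => (hρ k).1.le
  let D : Fin K → Beamformer M K →L[ℝ] ℝ := fun k =>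
    ∫ h, fderiv ℝ (utility P ρ v k (H k + h)) F₀ ∂(channelErrorLaw M (P.ω k ^ 2))
  obtain ⟨G, hG, hpos⟩ : ∃ G ∈ feasible P, 0 < ∑ k, D k (G - F₀) := by
    by_contra! hcon
    refine hns ⟨hF₀, _, hasFDerivAt_trueObjective hρ' F₀, fun G hG => ?_⟩
    rw [sum_apply]
    exact hcon G hG
  set d := ∑ k, D k (G - F₀) with hd
  -- Each device may lose d / (K + 1); the K losses together stay below d.
  have hη : 0 < d / (K + 1) := by positivity
  choose U hU hsmall using fun k => exists_isExponentiallySmall_sum_fderiv_le (v := v) (H := H)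
    hρ' hlaw hind k F₀ G (sub_lt_self (D k (G - F₀)) hη)
  refine ⟨⋂ k, U k, iInter_mem.2 hU, (IsExponentiallySmall.iUnion hsmall).mono ?_⟩
  -- For N = 0 the sample average objective is identically 0 and every feasible point is stationary
  -- for it.
  filter_upwards [eventually_gt_atTop 0] with N hN ω hω
  obtain ⟨F, hFU, hF⟩ := hω
  obtain ⟨-, f', hf', hstat⟩ := hF.isStationary hρ hv
  have hle := hstat G hG
  have hN' : (0 : ℝ) < N := Nat.cast_pos.2 hN
  rw [hf'.unique (hasFDerivAt_saaObjective P H _ hρ' F), smul_apply,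
    sum_apply, smul_eq_mul, one_div_mul_eq_div, div_le_iff₀ hN', zero_mul] at hle
  simp only [sum_apply] at hle
  rw [Finset.sum_comm] at hle
  by_contra hnot
  simp only [Set.mem_iUnion, Set.mem_ofPred_eq, not_exists, not_and, not_le] at hnot
  have hsum := Finset.sum_le_sum fun k (_ : k ∈ Finset.univ) =>
    (hnot k F (Set.mem_iInter.1 hFU k)).le
  rw [← Finset.mul_sum, Finset.sum_sub_distrib, ← hd, Finset.sum_const, Finset.card_univ,
    Fintype.card_fin, nsmul_eq_mul] at hsum
  have hgap : 0 < d - K * (d / (K + 1)) := by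
    have : d - K * (d / (K + 1)) = d / (K + 1) := by field_simp; ring
    rw [this]; exact hη
  exact (mul_pos hN' hgap).not_ge (hsum.trans hle)

end Concentration

end SWIPT

end

/-! ### The covering argument -/

theorem theorem2 {M K : ℕ} (P : SWIPT.System M K) (ρ v : Fin K → ℝ)
    (hρ : ∀ k, ρ k ∈ Set.Ioc (0 : ℝ) 1) (hv : ∀ k, 0 ≤ v k)
    (H : Fin K → SWIPT.Channel M)
    {Ω : Type*} [MeasurableSpace Ω] (μ : Measure Ω) [IsProbabilityMeasure μ]
    (φ : ℕ → Fin K → Ω → SWIPT.Channel M)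
    (hlaw : ∀ n k, HasLaw (φ n k) (SWIPT.channelErrorLaw M (P.ω k ^ 2)) μ)
    (hind : ∀ k, iIndepFun (fun n => φ n k) μ) :
    ∀ ε : ℝ, 0 < ε → ∃ a b : ℝ, 0 < a ∧ 0 < b ∧ ∀ᶠ N : ℕ in atTop,
      μ {ω | ∃ F : SWIPT.Beamformer M K,
          SWIPT.IsLimitingPoint P ρ v H (fun (n : Fin N) k => φ n k ω) F ∧
          ∀ G ∈ SWIPT.stationarySet P ρ v H, ε ≤ ‖F - G‖}
        ≤ ENNReal.ofReal (a * Real.exp (-(N : ℝ) * b)) := by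
  intro ε hε
  let T : Set (SWIPT.Beamformer M K) :=
    SWIPT.feasible P ∩ ⋂ G ∈ SWIPT.stationarySet P ρ v H, {F | ε ≤ ‖F - G‖}
  have hT : IsCompact T := (SWIPT.isCompact_feasible P).inter_right <|
    isClosed_biInter fun G _ => isClosed_le continuous_const (by fun_prop)
  have hsmall : SWIPT.IsExponentiallySmall μ fun N => {ω | ∃ F ∈ T,
      SWIPT.IsLimitingPoint P ρ v H (fun (n : Fin N) k => φ n k ω) F} := by
    -- Compactness reduces the claim to a neighbourhood of each point of T. Only monotonicity and
    -- finite subadditivity of μ enter, so the events need not be measurable.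
    refine hT.induction_on
      (p := fun T => SWIPT.IsExponentiallySmall μ fun N => {ω | ∃ F ∈ T,
        SWIPT.IsLimitingPoint P ρ v H (fun (n : Fin N) k => φ n k ω) F}) ?_ ?_ ?_ ?_
    · simpa using SWIPT.IsExponentiallySmall.empty
    · exact fun s t hst ht => ht.mono <| Eventually.of_forall fun N ω ⟨F, hF, hlim⟩ =>
        ⟨F, hst hF, hlim⟩
    · intro s t hs ht
      refine (hs.union ht).mono (Eventually.of_forall fun N ω ⟨F, hF, hlim⟩ => ?_)
      exact hF.imp (fun h => ⟨F, h, hlim⟩) fun h => ⟨F, h, hlim⟩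
    · intro F hF
      have hns : F ∉ SWIPT.stationarySet P ρ v H := fun hstat => by
        have : ε ≤ ‖F - F‖ := Set.mem_iInter₂.1 hF.2 F hstat
        simp only [sub_self, norm_zero] at this
        exact hε.not_ge this
      obtain ⟨U, hU, hp⟩ := SWIPT.exists_isExponentiallySmall_isLimitingPoint hρ hv hlaw hind
        hF.1 hns
      exact ⟨U, nhdsWithin_le_nhds hU, hp⟩
  exact hsmall.mono <| Eventually.of_forall fun N ω ⟨F, hlim, hfar⟩ =>
    ⟨F, ⟨hlim.mem_feasible, Set.mem_iInter₂.2 hfar⟩, hlim⟩
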